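/- Let $\sigma^z=\begin{pmatrix}1&0\\0&-1\end{pmatrix}$, $\sigma^+=|0\rangle\langle 1|$, $\sigma^-=|1\rangle\langle 0|$, and let $\sigma^z_j$ denote $\sigma^z$ acting on the $j$-th of $n$ qubits. The products in $\{\mathbb 1,\sigma^z,\sigma^+,\sigma^-\}^{\otimes n}$ form a basis of the $2^n\times 2^n$ complex matrices; the weight of a product is the number of its factors different from $\mathbb 1$. Fix constants $k,c,d\in\mathbb N$, and consider the following decision problem, ILP-QCOMMUTE-$k$-LOCAL (the constants $c,d$ make the bound "$O(\mathrm{poly}(n))$" in it precise). Input: $m$ linear constraints on $n$ binary variables, given by an integer matrix $C^M=(c_{ij})\in\mathbb Z^{m\times n}$ with entries written in binary; put $\hat C_i=\sum_{j=1}^n c_{ij}\sigma^z_j$. Question: is there a Hermitian $2^n\times 2^n$ matrix $H$ such that (i) at most $c(n+1)^d$ coefficients of $H$ in the above product basis are nonzero; (ii) every product with nonzero coefficient in $H$ has weight at most $k$; (iii) $[H,\hat C_i]=0$ for $i=1,\dots,m$; and (iv) $H$ has at least one nonzero off-diagonal entry in the computational (spin-$z$) basis? Theorem. For all constants $k,c,d$,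 this problem is in $\mathsf P$: there is a Turing machine that decides it in time polynomial in the length of the input. -/

import Mathlib

namespace QCommute

/-! ### Operators on `n` qubits -/

/-- Labels of the single-qubit basis `𝟙, σᶻ, σ⁺, σ⁻`. -/
inductive SiteOp
  | one
  | z
  | plus
  | minus
  deriving DecidableEq

instance : Fintype SiteOp where
  elems := {.one, .z, .plus, .minus}
  complete x := by cases x <;> simp

/-- The `2 × 2` matrix of a label, in the basis `|0⟩, |1⟩`; `σ⁺ = |0⟩⟨1|` and `σ⁻ = |1⟩⟨0|`. -/
def SiteOp.toMatrix : SiteOp → Matrix (Fin 2) (Fin 2) ℂ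
  | .one => 1
  | .z => !![1, 0; 0, -1]
  | .plus => !![0, 1; 0, 0]
  | .minus => !![0, 0; 1, 0]

/-- Operators on `ℂ^(2^n)`, as matrices in the computational (spin-z) basis `|x⟩`,
`x ∈ {0,1}^n`. -/
abbrev QubitOp (n : ℕ) : Type := Matrix (Fin n → Fin 2) (Fin n → Fin 2) ℂ

/-- The tensor product `A₁ ⊗ ⋯ ⊗ Aₙ` of single-qubit operators. -/
def tensorOp {n : ℕ} (A : Fin n → Matrix (Fin 2) (Fin 2) ℂ) : QubitOp n :=
  Matrix.of fun x y => ∏ i, A i (x i) (y i)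

/-- The operator `σᶻ_j`, acting as `σᶻ` on qubit `j` and as the identity on the others. -/
def sigmaZ {n : ℕ} (j : Fin n) : QubitOp n :=
  tensorOp fun i => if i = j then SiteOp.z.toMatrix else 1

/-- The embedded constraint operator `Ĉ = ∑ⱼ cⱼ σᶻ_j`. -/
def constraintOp {n : ℕ} (c : Fin n → ℤ) : QubitOp n :=
  ∑ j, (c j : ℂ) • sigmaZ j

/-- The element of the product basis `{𝟙, σᶻ, σ⁺, σ⁻}^{⊗n}` with factor `s i` on qubit `i`. -/
def basisTerm {n : ℕ} (s : Fin n → SiteOp) : QubitOp n :=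
  tensorOp fun i => (s i).toMatrix

/-- The weight of a product term: the number of qubits on which it is not the identity. -/
def weight {n : ℕ} (s : Fin n → SiteOp) : ℕ :=
  (Finset.univ.filter fun i => s i ≠ SiteOp.one).card

/-! ### The decision problem -/

/-- An instance: `m` linear constraints on `n` variables with integer coefficients; row `i` of
`coeff` is the coefficient vector of the `i`-th constraint. -/
structure Instance where
  /-- the number of constraints -/
  m : ℕ
  /-- the number of variables -/
  n : ℕ
  /-- the matrix of coefficients -/
  coeff : Matrix (Fin m) (Fin n) ℤ

/-- ILP-QCOMMUTE-k-LOCAL: is there a Hermitian `H` which commutes with all the constraint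
operators, has a nonzero off-diagonal entry in the spin-z basis, and whose expansion
`H = ∑ₛ αₛ · (basis term s)` has at most `c (n+1)^d` nonzero coefficients and no term of weight
larger than `k`?  The constants `c`, `d` fix the bound meant by `O(poly(n))`. -/
def KLocal (k c d : ℕ) (I : Instance) : Prop :=
  ∃ (H : QubitOp I.n) (α : (Fin I.n → SiteOp) → ℂ),
    H = ∑ s, α s • basisTerm s ∧
    {s | α s ≠ 0}.ncard ≤ c * (I.n + 1) ^ d ∧
    (∀ s, α s ≠ 0 → weight s ≤ k) ∧
    H.IsHermitian ∧
    (∀ i, H * constraintOp (I.coeff i) = constraintOp (I.coeff i) * H) ∧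
    ∃ x y, x ≠ y ∧ H x y ≠ 0

/-! ### The encoding of instances -/

open Computability (Γ' encodeNat)

/-- Binary encoding of an integer: a sign bit, then the binary digits of the absolute value,
least significant first. -/
def encodeInt (z : ℤ) : List Γ' :=
  Γ'.bit (decide (z < 0)) :: (encodeNat z.natAbs).map Γ'.bit

/-- A list of integers, each one followed by a comma. -/
def encodeColumn (l : List ℤ) : List Γ' :=
  l.flatMap fun z => encodeInt z ++ [Γ'.comma]

/-- The number `m` of rows in unary, then the columns of the coefficient matrix one after the
other, each one closed by a `ket`. -/
def encodeInstance (I : Instance) : List Γ' :=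
  List.replicate I.m Γ'.bra ++
    (List.ofFn fun j => List.ofFn fun i => I.coeff i j).flatMap
      fun col => encodeColumn col ++ [Γ'.ket]

theorem encodeInt_injective : Function.Injective encodeInt := by
  intro a b h
  simp only [encodeInt, List.cons.injEq, Γ'.bit.injEq, decide_eq_decide] at h
  have h2 : a.natAbs = b.natAbs := Computability.encodingNatBool.encode_injective
    (List.map_injective_iff.2 (fun _ _ h => Γ'.bit.inj h) h.2)
  omega

theorem append_sep_cancel {Γ : Type} {s : Γ} : ∀ {u v u' v' : List Γ}, s ∉ u → s ∉ v →
    u ++ s :: u' = v ++ s :: v' → u = v ∧ u' = v'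
  | [], [], _, _, _, _, h => by simpa using h
  | [], _ :: _, _, _, _, hv, h => by simp at h hv; exact absurd h.1 hv.1
  | _ :: _, [], _, _, hu, _, h => by simp at h hu; exact absurd h.1.symm hu.1
  | _ :: u, _ :: v, u', v', hu, hv, h => by
    simp only [List.cons_append, List.cons.injEq] at h
    simp only [List.mem_cons, not_or] at hu hv
    have := append_sep_cancel hu.2 hv.2 h.2
    simp [h.1, this.1, this.2]

theorem flatMap_sep_injective {α Γ : Type} (f : α → List Γ) (s : Γ)
    (hf : Function.Injective f) (hs : ∀ a, s ∉ f a) :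
    Function.Injective fun l : List α => l.flatMap fun a => f a ++ [s] := by
  intro l
  induction l with
  | nil => intro l' h; cases l' <;> simp_all
  | cons a l ih =>
    intro l' h
    cases l' with
    | nil => simp at h
    | cons b l' =>
      simp only [List.flatMap_cons, List.append_assoc, List.singleton_append] at h
      obtain ⟨h1, h2⟩ := append_sep_cancel (hs a) (hs b) h
      rw [hf h1, ih h2]

theorem encodeInstance_injective : Function.Injective encodeInstance := by
  have hcol : Function.Injective encodeColumn :=
    flatMap_sep_injective encodeInt Γ'.comma encodeInt_injective (by simp [encodeInt])
  have hmat := flatMap_sep_injective encodeColumn Γ'.ket hcol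
    (by simp [encodeColumn, encodeInt])
  have hbra : ∀ l : List (List ℤ),
      Γ'.bra ∉ l.flatMap fun col => encodeColumn col ++ [Γ'.ket] := by
    simp [encodeColumn, encodeInt]
  rintro ⟨m, n, C⟩ ⟨m', n', C'⟩ h
  simp only [encodeInstance] at h
  have hm : m = m' := by
    have := congrArg (List.count Γ'.bra) h
    simpa [List.count_append, List.count_eq_zero_of_not_mem (hbra _)] using this
  subst hm
  have h2 := hmat (List.append_cancel_left h)
  have hn : n = n' := by simpa using congrArg List.length h2
  subst hn
  congr 1
  ext i j
  exact congrFun (List.ofFn_injective (congrFun (List.ofFn_injective h2) j)) i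

/-- The encoding of instances as strings over a finite alphabet. -/
noncomputable def instanceEncoding : Computability.Encoding Instance Γ' where
  encode := encodeInstance
  decode := Function.partialInv encodeInstance
  decode_encode := Function.partialInv_left encodeInstance_injective

/-! ### Polynomial time -/

/-- The decision problem `p`, with instances given through the encoding `e`, is in `P`: a Turing
machine halts on the encoding of each instance `a` within a number of steps polynomial in the
length of that encoding, with the truth value of `p a` as output. -/
def InP {α Γ : Type} [Fintype Γ] (e : Computability.Encoding α Γ) (p : α → Prop) : Prop :=
  ∃ f : α → Bool, (∀ a, f a = true ↔ p a) ∧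
    Nonempty (Turing.TM2ComputableInPolyTime e.encode Computability.encodeBool f)

end QCommute

/-! The constraint operators are diagonal in the spin-z basis, so `H` commutes with them exactly
when every nonzero entry `H x y` joins two strings with equal eigenvalues. A product term is nonzero
at `(x, y)` only if the spins of `x` and `y` differ by twice its jump vector, which is `1` at each
`σ⁺`, `-1` at each `σ⁻` and `0` elsewhere. An off-diagonal entry of `H` therefore yields a nonzero
`u ∈ {-1,0,1}^n` in the kernel of the coefficient matrix with at most `k` nonzero entries.
Conversely, such a `u` gives `H = T + T†`, with `T` the product of `σ⁺` and `σ⁻` prescribed by `u`.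
Hermiticity forces at least two terms, so the bound on their number must be at least `2`; for `n ≥
1` this depends on `c` and `d` alone. This is `kLocal_iff`.

Since `k` is constant, `u` can be found by brute force: `Reachable k` sets a mark on some column to
`±1`, `k` times in succession, and then tests whether the marked sum of the columns vanishes.
Overwriting a mark is allowed, which covers supports smaller than `k`; a mark never returns to `0`,
so `u ≠ 0` as soon as `k ≠ 0` (`reachable_unmarked_iff`).

Integers are written with binary digits in `{-1,0,1}`. Negation is then digitwise, addition needs no
comparison of signs, and zero has only all-zero expansions (`rowVal_eq_zero_iff`). Partial sums stay
linear in the input length (`length_encCol_colAdd`, `run_sumLoop`), so each candidate is tested in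
polynomial time.

The search is a program in a small stack language whose semantics `Prog.Run` counts steps;
`Prog.Run.reachesIn` and `inP_of_prog` turn its bounds into bounds for a Turing machine. -/

namespace QCommute

/-! ### A stack language and its compilation to multi-stack Turing machines. -/

open Turing Function

/-! ### A small imperative language on stacks -/

/-- Programs acting on a family of stacks indexed by `K`, with symbols in `G`. -/
inductive Prog (K G : Type) : Type
  | skip : Prog K G
  | push (k : K) (a : G) : Prog K G
  /-- Pop a symbol and branch on the result. -/
  | pop (k : K) (f : Option G → Prog K G) : Prog K G
  | seq (p q : Prog K G) : Prog K G
  /-- While the stack `k` is nonempty, pop a symbol `a` and execute `f a`. -/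
  | loop (k : K) (f : G → Prog K G) : Prog K G

namespace Prog

variable {K G : Type}

/-- `p.Run S S' n`: started on the stacks `S`, the program `p` terminates with the stacks `S'`
after at most `n` steps. -/
inductive Run [DecidableEq K] : Prog K G → (K → List G) → (K → List G) → ℕ → Prop
  | skip (S) : Run skip S S 1
  | push (k a S) : Run (push k a) S (update S k (a :: S k)) 1
  | pop {k f S S' n} : Run (f (S k).head?) (update S k (S k).tail) S' n → Run (pop k f) S S' (n + 1)
  | seq {p q S S' S'' n n'} : Run p S S' n → Run q S' S'' n' → Run (seq p q) S S'' (n + n')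
  | loop_nil {k f S} : S k = [] → Run (loop k f) S S 1
  | loop_cons {k f S S' S'' a l n n'} : S k = a :: l → Run (f a) (update S k l) S' n →
      Run (loop k f) S' S'' n' → Run (loop k f) S S'' (n + n' + 1)
  | mono {p S S' n n'} : Run p S S' n → n ≤ n' → Run p S S' n'

/-- The control positions of a program. -/
def Pos : Prog K G → Type
  | skip => Unit
  | push _ _ => Unit
  | pop _ f => Option (Σ o, (f o).Pos)
  | seq p q => p.Pos ⊕ q.Pos
  | loop _ f => Option (Σ a, (f a).Pos)

/-- The position at which a program starts. -/
def entry : (p : Prog K G) → p.Pos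
  | skip => ()
  | push _ _ => ()
  | pop _ _ => none
  | seq p _ => Sum.inl p.entry
  | loop _ _ => none

/-- A Turing machine needs finitely many labels. Branching over symbols keeps the positions finite
because the alphabet is finite. -/
theorem finite_pos [Finite G] : ∀ p : Prog K G, Finite p.Pos
  | skip => inferInstanceAs (Finite Unit)
  | push _ _ => inferInstanceAs (Finite Unit)
  | pop _ f =>
    have := fun o => finite_pos (f o)
    inferInstanceAs (Finite (Option (Σ o, (f o).Pos)))
  | seq p q =>
    have := finite_pos p
    have := finite_pos q
    inferInstanceAs (Finite (p.Pos ⊕ q.Pos))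
  | loop _ f =>
    have := fun o => finite_pos (f o)
    inferInstanceAs (Finite (Option (Σ o, (f o).Pos)))

end Prog

/-! ### Compilation to Turing machines -/

/-- The stacks of the compiled machine: an input stack, an output stack, and the stacks of the
program. -/
inductive Tape (K : Type) : Type
  | input
  | output
  | work (k : K)
  deriving DecidableEq, Fintype

/-- The alphabets of the compiled machine. -/
abbrev Tape.Symbol {K : Type} (A G : Type) : Tape K → Type
  | input => A
  | output => Bool
  | work _ => G

/-- The contents of all stacks of the compiled machine. -/
def Tape.stacks {K A G : Type} (l : List A) (o : List Bool) (S : K → List G) :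
    (t : Tape K) → List (t.Symbol A G)
  | input => l
  | output => o
  | work k => S k

section

variable {K A G : Type} [DecidableEq K]

theorem Tape.update_work (l : List A) (o : List Bool) (S : K → List G) (k : K) (w : List G) :
    update (Tape.stacks l o S) (.work k) w = Tape.stacks l o (update S k w) := by
  funext t
  cases t with
  | input => rfl
  | output => rfl
  | work j =>
    by_cases h : j = k
    · subst h; simp [Tape.stacks]
    · simp [Tape.stacks, h]

theorem Tape.update_input (l l' : List A) (o : List Bool) (S : K → List G) :
    update (Tape.stacks l o S) .input l' = Tape.stacks l' o S := by
  funext t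
  cases t <;> simp [Tape.stacks]

theorem Tape.update_output (l : List A) (o o' : List Bool) (S : K → List G) :
    update (Tape.stacks l o S) .output o' = Tape.stacks l o' S := by
  funext t
  cases t <;> simp [Tape.stacks]

/-- The statement at each position of a program; `ι` embeds the positions into the labels of the
machine and `ex` is the label at which the execution continues afterwards. -/
def Prog.code {Λ : Type} : (p : Prog K G) → (p.Pos → Λ) → Λ → p.Pos →
    TM2.Stmt (Tape.Symbol A G : Tape K → Type) Λ (Option A × Option G)
  | .skip, _, ex, _ => .goto fun _ => ex
  | .push k a, _, ex, _ => .push (.work k) (fun _ => a) (.goto fun _ => ex)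
  | .pop k f, ι, _, none =>
    .pop (.work k) (fun v o => (v.1, o)) (.goto fun v => ι (some ⟨v.2, (f v.2).entry⟩))
  | .pop _ f, ι, ex, some ⟨o, x⟩ => (f o).code (fun y => ι (some ⟨o, y⟩)) ex x
  | .seq p q, ι, _, .inl x => p.code (fun y => ι (.inl y)) (ι (.inr q.entry)) x
  | .seq _ q, ι, ex, .inr x => q.code (fun y => ι (.inr y)) ex x
  | .loop k f, ι, ex, none =>
    .pop (.work k) (fun v o => (v.1, o))
      (.goto fun v => v.2.elim ex fun a => ι (some ⟨a, (f a).entry⟩))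
  | .loop _ f, ι, _, some ⟨a, x⟩ => (f a).code (fun y => ι (some ⟨a, y⟩)) (ι none) x

/-- `c'` is reached from `c` in at most `n` steps. -/
def ReachesIn {α : Type} (f : α → Option α) (c c' : α) (n : ℕ) : Prop :=
  ∃ t ≤ n, (flip bind f)^[t] (some c) = some c'

theorem ReachesIn.single {α : Type} {f : α → Option α} {c c' : α} (h : f c = some c') :
    ReachesIn f c c' 1 :=
  ⟨1, le_rfl, h⟩

theorem ReachesIn.trans {α : Type} {f : α → Option α} {a b c : α} {m n : ℕ}
    (h : ReachesIn f a b m) (h' : ReachesIn f b c n) : ReachesIn f a c (m + n) := by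
  obtain ⟨s, hs, h⟩ := h
  obtain ⟨t, ht, h'⟩ := h'
  exact ⟨t + s, by omega, by rw [iterate_add_apply, h, h']⟩

theorem ReachesIn.mono {α : Type} {f : α → Option α} {a b : α} {m n : ℕ}
    (h : ReachesIn f a b m) (hmn : m ≤ n) : ReachesIn f a b n :=
  h.imp fun _ ht => ⟨ht.1.trans hmn, ht.2⟩

/-- Simulation at the same cost: each counted step of the program is one machine step. Quantifying
over `ι` and `ex` lets the induction treat a subprogram embedded in a larger machine. -/
theorem Prog.Run.reachesIn {Λ : Type}
    {M : Λ → TM2.Stmt (Tape.Symbol A G : Tape K → Type) Λ (Option A × Option G)}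
    {p : Prog K G} {S S' : K → List G} {n : ℕ} (h : p.Run S S' n) (l : List A) (o : List Bool) :
    ∀ (ι : p.Pos → Λ) (ex : Λ), (∀ x, M (ι x) = p.code ι ex x) → ∀ v, ∃ v',
      ReachesIn (TM2.step M) ⟨some (ι p.entry), v, Tape.stacks l o S⟩
        ⟨some ex, v', Tape.stacks l o S'⟩ n := by
  induction h with
  | skip S =>
    intro ι ex hM v
    exact ⟨v, .single (by simp [hM, Prog.code])⟩
  | push k a S =>
    intro ι ex hM v
    refine ⟨v, .single ?_⟩
    rw [TM2.step, hM]
    simp only [Prog.code, TM2.stepAux]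
    congr 2
    exact Tape.update_work ..
  | @pop k f S S' n h ih =>
    intro ι ex hM v
    obtain ⟨v', hv⟩ := ih (fun y => ι (some ⟨_, y⟩)) ex (fun x => hM _) (v.1, (S k).head?)
    refine ⟨v', ReachesIn.mono (.trans (.single ?_) hv) (add_comm _ _).le⟩
    rw [TM2.step, hM]
    simp only [Prog.entry, Prog.code, TM2.stepAux]
    congr 2
    exact Tape.update_work ..
  | seq _ _ ih ih' =>
    intro ι ex hM v
    obtain ⟨v', hv⟩ := ih (fun y => ι (.inl y)) _ (fun x => hM _) v
    obtain ⟨v'', hv'⟩ := ih' (fun y => ι (.inr y)) ex (fun x => hM _) v'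
    exact ⟨v'', hv.trans hv'⟩
  | @loop_nil k f S h =>
    intro ι ex hM v
    refine ⟨(v.1, none), .single ?_⟩
    rw [TM2.step, hM]
    simp only [Prog.entry, Prog.code, TM2.stepAux]
    rw [show (Tape.stacks l o S (.work k) : List G) = [] from h]
    simp only [List.head?_nil, Option.elim, List.tail_nil]
    congr 2
    exact (Tape.update_work ..).trans (by rw [← h, update_eq_self])
  | @loop_cons k f S S' S'' a w n n' h _ _ ih ih' =>
    intro ι ex hM v
    obtain ⟨v', hv⟩ := ih (fun y => ι (some ⟨_, y⟩)) (ι none) (fun x => hM _) (v.1, some a)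
    obtain ⟨v'', hv'⟩ := ih' ι ex hM v'
    refine ⟨v'', ReachesIn.mono (.trans (.single ?_) (hv.trans hv')) (add_comm _ _).le⟩
    rw [TM2.step, hM]
    simp only [Prog.entry, Prog.code, TM2.stepAux]
    rw [show (Tape.stacks l o S (.work k) : List G) = a :: w from h]
    simp only [List.head?_cons, Option.elim, List.tail_cons]
    congr 2
    exact Tape.update_work ..
  | mono _ hn ih =>
    intro ι ex hM v
    obtain ⟨v', hv⟩ := ih ι ex hM v
    exact ⟨v', hv.mono hn⟩

/-- The labels of the compiled machine. -/
inductive Phase (P : Type) : Type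
  | read
  | run (x : P)
  | finish
  deriving Fintype

/-- The compiled program: it moves the input to the stack `src`, runs `p`, and outputs whether the
stack `res` is nonempty. -/
def Prog.machine (p : Prog K G) (src res : K) (emb : Option A → G) :
    Phase p.Pos → TM2.Stmt (Tape.Symbol A G : Tape K → Type) (Phase p.Pos) (Option A × Option G)
  | .read => .pop .input (fun v o => (o, v.2)) (.branch (fun v => v.1.isSome)
      (.push (.work src) (fun v => emb v.1) (.goto fun _ => .read)) (.goto fun _ => .run p.entry))
  | .run x => p.code .run .finish x
  | .finish => .pop (.work res) (fun v o => (v.1, o))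
      (.push .output (fun v => v.2.isSome) (.load (fun _ => (none, none)) .halt))

theorem Prog.machine_read (p : Prog K G) (src res : K) (emb : Option A → G) (l : List A) :
    ∀ (v : Option A × Option G) (S : K → List G), ∃ v',
      ReachesIn (TM2.step (p.machine src res emb)) ⟨some .read, v, Tape.stacks l [] S⟩
        ⟨some (.run p.entry), v',
          Tape.stacks [] [] (update S src ((l.map fun a => emb (some a)).reverse ++ S src))⟩
        (l.length + 1) := by
  induction l with
  | nil =>
    intro v S
    refine ⟨(none, v.2), .single ?_⟩
    simp only [TM2.step, machine, TM2.stepAux]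
    simp [Tape.stacks, Tape.update_input]
  | cons a l ih =>
    intro v S
    obtain ⟨v', h⟩ := ih (some a, v.2) (update S src (emb (some a) :: S src))
    refine ⟨v', ?_⟩
    have : ReachesIn (TM2.step (p.machine src res emb)) ⟨some .read, v, Tape.stacks (a :: l) [] S⟩
        ⟨some .read, (some a, v.2), Tape.stacks l [] (update S src (emb (some a) :: S src))⟩ 1 := by
      refine .single ?_
      simp only [TM2.step, machine, TM2.stepAux]
      rw [show Tape.stacks (a :: l) [] S .input = a :: l from rfl]
      simp only [List.tail_cons, List.head?_cons, Option.isSome_some, cond_true, Tape.update_input]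
      congr 2
      exact Tape.update_work ..
    have h' := (this.trans h).mono (n := (a :: l).length + 1) (by simp; omega)
    simpa using h'

/-- A problem is in `P` if it is decided by a program in polynomial time. -/
theorem inP_of_prog {α : Type} [Fintype A] [Fintype G] [Fintype K]
    (e : Computability.Encoding α A) (P : α → Prop) (p : Prog K G) (src res : K)
    (emb : Option A → G) (q : Polynomial ℕ)
    (h : ∀ a, ∃ r : List G, r.length ≤ 1 ∧ (r ≠ [] ↔ P a) ∧
      p.Run (update (fun _ => []) src ((e.encode a).map fun x => emb (some x)).reverse)
        (update (fun _ => []) res r) (q.eval (e.encode a).length)) :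
    InP e P := by
  classical
  have := p.finite_pos
  let _ : Fintype p.Pos := Fintype.ofFinite _
  let tm : FinTM2 :=
    { K := Tape K
      k₀ := .input
      k₁ := .output
      Γ := Tape.Symbol A G
      Λ := Phase p.Pos
      main := .read
      σ := Option A × Option G
      initialState := (none, none)
      Γk₀Fin := inferInstanceAs (Fintype A)
      m := p.machine src res emb }
  -- Reading the input costs its length plus one, and the final phase costs one step.
  refine ⟨fun a => decide (P a), by simp, ⟨⟨⟨tm, Equiv.refl _, Equiv.refl _⟩, q + Polynomial.X + 2, ?_⟩⟩⟩
  intro a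
  refine Classical.choice ?_
  obtain ⟨r, hr, hP, hrun⟩ := h a
  set l := e.encode a
  obtain ⟨v, h1⟩ := p.machine_read src res emb l (none, none) (fun _ => [])
  obtain ⟨v', h2⟩ := hrun.reachesIn (M := p.machine src res emb) [] [] .run .finish (fun x => rfl) v
  rw [List.append_nil] at h1
  have h3 : ReachesIn (TM2.step (p.machine src res emb))
      ⟨some .finish, v', Tape.stacks [] [] (update (fun _ => []) res r)⟩
      ⟨none, (none, none), Tape.stacks [] [decide (P a)] (fun _ => [])⟩ 1 := by
    -- A halting configuration must have the initial state and empty stacks apart from the output;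
    -- this is why `r` has at most one symbol and every other stack must end empty.
    refine .single ?_
    simp only [TM2.step, Prog.machine, TM2.stepAux]
    congr 2
    have hr' : r.tail = [] := by rcases r with _ | ⟨x, _ | ⟨y, r⟩⟩ <;> simp_all
    have hs : r.head?.isSome = decide (P a) := by
      rcases r with _ | ⟨x, r⟩ <;> simp_all
    have e1 : (Tape.stacks [] [] (update (fun _ => []) res r) : (t : Tape K) → List (t.Symbol A G))
      (.work res) = r := by simp [Tape.stacks]
    rw [e1, hr', hs]
    have e2 : update (Tape.stacks [] [] (update (fun _ => []) res r) :
        (t : Tape K) → List (t.Symbol A G)) (.work res) [] = Tape.stacks [] [] fun _ => [] := by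
      refine (Tape.update_work ..).trans ?_
      congr 1
      funext x
      by_cases hx : x = res <;> simp [hx]
    rw [e2]
    exact Tape.update_output ..
  obtain ⟨t, ht, hsteps⟩ := (h1.trans h2).trans h3
  refine ⟨⟨⟨t, ?_⟩, ?_⟩⟩
  · have hi : initList tm (List.map (Equiv.refl (tm.Γ tm.k₀)).invFun l) =
        (⟨some .read, (none, none), Tape.stacks l [] fun _ => []⟩ :
          TM2.Cfg (Tape.Symbol A G : Tape K → Type) (Phase p.Pos) (Option A × Option G)) := by
      simp only [initList, tm]
      congr 1
      funext t
      cases t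
      · simp [Tape.stacks]
      · simp [Tape.stacks]
      · simp [Tape.stacks]
    have ho : haltList tm (List.map (Equiv.refl (tm.Γ tm.k₁)).invFun
        (Computability.encodeBool (decide (P a)))) =
        (⟨none, (none, none), Tape.stacks [] [decide (P a)] fun _ => []⟩ :
          TM2.Cfg (Tape.Symbol A G : Tape K → Type) (Phase p.Pos) (Option A × Option G)) := by
      simp only [haltList, tm]
      congr 1
      funext t
      cases t
      · simp [Tape.stacks]
      · simp [Tape.stacks, Computability.encodeBool]
      · simp [Tape.stacks]
    exact (congrArg (fun c => (flip bind tm.step)^[t] (some c)) hi).trans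
      (hsteps.trans (congrArg some ho.symm))
  · refine ht.trans ?_
    simp
    omega

end

end QCommute

/-! ### Elementary stack programs, signed-digit arithmetic and strings for columns. -/

namespace QCommute

open Turing Function
open Computability (Γ')

/-! ### Basic programs -/

namespace Prog

variable {K G : Type} [DecidableEq K]

theorem Run.congr {p : Prog K G} {S S' S'' : K → List G} {n n' : ℕ} (h : p.Run S S' n)
    (hS : S' = S'') (hn : n ≤ n') : p.Run S S'' n' :=
  hS ▸ h.mono hn

theorem run_clear (a : K) : ∀ (l : List G) (S : K → List G), S a = l →
    (loop a fun _ => skip : Prog K G).Run S (update S a []) (2 * l.length + 1)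
  | [], S, h => (Run.loop_nil h).congr (by rw [← h, update_eq_self]) (by simp)
  | x :: l, S, h =>
    (Run.loop_cons h (.skip _) (run_clear a l _ (update_self ..))).congr (by simp)
      (by simp; omega)

theorem run_move {a b : K} (hab : a ≠ b) (f : G → G) : ∀ (l : List G) (S : K → List G), S a = l →
    (loop a fun x => push b (f x)).Run S (update (update S a []) b ((l.map f).reverse ++ S b))
      (2 * l.length + 1)
  | [], S, h => by
    refine (Run.loop_nil h).congr ?_ (by simp)
    funext x
    simp only [update_apply, List.map_nil, List.reverse_nil, List.nil_append]
    split_ifs with h1 h2 <;> simp_all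
  | x :: l, S, h => by
    refine (Run.loop_cons (f := fun x => push b (f x)) h (.push b (f x) _)
      (run_move hab f l _ ?_)).congr ?_ ?_
    · simp [hab]
    · funext y
      simp only [update_apply]
      split_ifs <;> simp_all
    · simp
      omega

theorem run_move_both {a b c : K} (hab : a ≠ b) (hac : a ≠ c) (hbc : b ≠ c) :
    ∀ (l : List G) (S : K → List G), S a = l →
    (loop a fun x => seq (push b x) (push c x)).Run S
      (update (update (update S a []) b (l.reverse ++ S b)) c (l.reverse ++ S c)) (3 * l.length + 1)
  | [], S, h => by
    refine (Run.loop_nil h).congr ?_ (by simp)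
    funext x
    simp only [update_apply, List.reverse_nil, List.nil_append]
    split_ifs <;> simp_all
  | x :: l, S, h => by
    refine (Run.loop_cons h (.seq (.push _ _ _) (.push _ _ _))
      (run_move_both hab hac hbc l _ ?_)).congr ?_ (by simp; omega)
    · simp [hab, hac]
    · funext y
      simp only [update_apply]
      split_ifs <;> simp_all

end Prog

/-! ### Signed digits -/

/-- The integer with the given signed binary digits, least significant first. -/
def rowVal : List SignType → ℤ
  | [] => 0
  | d :: x => d + 2 * rowVal x

/-- The carry in a signed digit addition. -/
def carryOut (v : ℤ) : SignType :=
  if 2 ≤ v then 1 else if v ≤ -2 then -1 else 0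

/-- The digit in a signed digit addition. -/
def digitOut (v : ℤ) : SignType :=
  if v % 2 = 0 then 0 else if 0 < v then 1 else -1

/-- Two signed digits and a carry sum to at most `3` in absolute value, so digit and carry again fit
in `{-1,0,1}`. -/
theorem digitOut_add_carryOut {v : ℤ} (h : |v| ≤ 3) :
    (digitOut v : ℤ) + 2 * (carryOut v : ℤ) = v := by
  rw [abs_le] at h
  obtain ⟨h1, h2⟩ := h
  interval_cases v <;> decide

theorem abs_signType_le (s : SignType) : |(s : ℤ)| ≤ 1 := by
  cases s <;> decide

/-- Addition of signed digit expansions, with incoming carry. -/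
def rowAdd : SignType → List SignType → List SignType → List SignType
  | c, x :: xs, y :: ys => digitOut (x + y + c) :: rowAdd (carryOut (x + y + c)) xs ys
  | c, x :: xs, [] => digitOut (x + c) :: rowAdd (carryOut (x + c)) xs []
  | c, [], y :: ys => digitOut (y + c) :: rowAdd (carryOut (y + c)) [] ys
  | c, [], [] => [c]

theorem rowVal_rowAdd (c : SignType) (x y : List SignType) :
    rowVal (rowAdd c x y) = c + rowVal x + rowVal y := by
  induction c, x, y using rowAdd.induct with
  | case1 c x xs y ys ih =>
    have h := digitOut_add_carryOut (v := x + y + c) <| by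
      have := abs_add_three (x : ℤ) y c
      linarith [abs_signType_le x, abs_signType_le y, abs_signType_le c]
    simp only [rowAdd, rowVal, ih]
    linarith
  | case2 c x xs ih =>
    have h := digitOut_add_carryOut (v := x + c) <| by
      have := abs_add_le (x : ℤ) c
      linarith [abs_signType_le x, abs_signType_le c]
    simp only [rowAdd, rowVal, ih]
    linarith
  | case3 c y ys ih =>
    have h := digitOut_add_carryOut (v := y + c) <| by
      have := abs_add_le (y : ℤ) c
      linarith [abs_signType_le y, abs_signType_le c]
    simp only [rowAdd, rowVal, ih]
    linarith
  | case4 c => simp [rowAdd, rowVal]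

theorem length_rowAdd_le (c : SignType) (x y : List SignType) :
    (rowAdd c x y).length ≤ x.length + y.length + 1 := by
  induction c, x, y using rowAdd.induct <;> (simp_all [rowAdd]; try omega)

/-- Although signed-digit expansions are not unique, zero is rigid: parity forces the lowest digit
to vanish, and one halves and repeats. -/
theorem rowVal_eq_zero_iff (x : List SignType) : rowVal x = 0 ↔ ∀ d ∈ x, d = 0 := by
  induction x with
  | nil => simp [rowVal]
  | cons d x ih =>
    rw [List.forall_mem_cons, ← ih, rowVal]
    cases d
    · simp
    · simp
      omega
    · simp
      omega

theorem rowVal_map_mul (m : SignType) (x : List SignType) :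
    rowVal (x.map (m * ·)) = m * rowVal x := by
  induction x with
  | nil => simp [rowVal]
  | cons d x ih =>
    simp only [List.map_cons, rowVal, ih, SignType.coe_mul]
    ring

/-! ### Columns of integers -/

/-- A column: a list of integers given by their signed digits. -/
abbrev Column : Type := List (List SignType)

/-- Sum of two columns. -/
def colAdd : Column → Column → Column
  | [], _ => []
  | x :: X, Y => rowAdd 0 x (Y.headD []) :: colAdd X Y.tail

/-- Multiple of a column by a sign. -/
def colSMul (m : SignType) (X : Column) : Column :=
  X.map fun x => x.map (m * ·)

/-- The sum of `Y` and all columns in a list, each one multiplied by its mark. -/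
def total (L : List (Column × SignType)) (Y : Column) : Column :=
  L.foldl (fun Y c => colAdd (colSMul c.2 c.1) Y) Y

@[simp]
theorem length_colAdd : ∀ X Y : Column, (colAdd X Y).length = X.length
  | [], _ => rfl
  | _ :: X, Y => by simp [colAdd, length_colAdd X Y.tail]

@[simp]
theorem length_colSMul (m : SignType) (X : Column) : (colSMul m X).length = X.length := by
  simp [colSMul]

/-- The `i`-th integer in a column; `0` if there is none. -/
def colVal (X : Column) (i : ℕ) : ℤ :=
  rowVal (X.getD i [])

theorem colVal_colAdd : ∀ (X Y : Column) (i : ℕ), i < X.length →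
    colVal (colAdd X Y) i = colVal X i + colVal Y i
  | [], _, _, h => by simp at h
  | x :: X, Y, 0, _ => by
    cases Y <;> simp [colVal, colAdd, rowVal_rowAdd]
  | x :: X, Y, i + 1, h => by
    have := colVal_colAdd X Y.tail i (by simpa using h)
    cases Y <;> simpa [colVal, colAdd] using this

theorem colVal_colSMul (m : SignType) (X : Column) (i : ℕ) :
    colVal (colSMul m X) i = m * colVal X i := by
  by_cases h : i < X.length
  · simp [colVal, colSMul, h, rowVal_map_mul]
  · simp [colVal, colSMul, h, rowVal]

theorem colVal_total {r : ℕ} (i : ℕ) (hi : i < r) : ∀ (L : List (Column × SignType)) (Y : Column),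
    (∀ c ∈ L, c.1.length = r) →
    colVal (total L Y) i = colVal Y i + (L.map fun c => (c.2 : ℤ) * colVal c.1 i).sum
  | [], Y, _ => by simp [total]
  | c :: L, Y, h => by
    have h1 := colVal_total i hi L (colAdd (colSMul c.2 c.1) Y)
      (fun c hc => h c (List.mem_cons_of_mem _ hc))
    rw [colVal_colAdd _ _ _ (by simp [h c]; exact hi), colVal_colSMul] at h1
    simp only [total, List.foldl_cons, List.map_cons, List.sum_cons] at h1 ⊢
    rw [h1]
    ring

theorem length_total {r : ℕ} : ∀ (L : List (Column × SignType)) (Y : Column),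
    (∀ c ∈ L, c.1.length = r) → Y.length ≤ r → (total L Y).length ≤ r
  | [], _, _, h => h
  | c :: L, Y, h, _ => by
    refine length_total L (colAdd (colSMul c.2 c.1) Y)
      (fun c hc => h c (List.mem_cons_of_mem _ hc)) ?_
    simp [h c]

/-! ### Strings representing columns -/

/-- The symbols on the stacks: symbols of the raw input, signed digits, separators, and ends of
columns, which carry a mark. -/
inductive Letter : Type
  | raw (g : Γ')
  | dig (s : SignType)
  | comma
  | ket (s : SignType)
  deriving DecidableEq, Fintype

open Letter

/-- The string of a column. -/
def encCol (X : Column) : List Letter :=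
  X.flatMap fun x => x.map dig ++ [comma]

/-- The string of a list of marked columns. -/
def encCols (L : List (Column × SignType)) : List Letter :=
  L.flatMap fun c => encCol c.1 ++ [ket c.2]

@[simp] theorem encCol_nil : encCol [] = [] := rfl

@[simp] theorem encCol_cons (x : List SignType) (X : Column) :
    encCol (x :: X) = x.map dig ++ comma :: encCol X := by
  simp [encCol]

@[simp] theorem encCols_nil : encCols [] = [] := rfl

@[simp] theorem encCols_cons (c : Column × SignType) (L : List (Column × SignType)) :
    encCols (c :: L) = encCol c.1 ++ ket c.2 :: encCols L := by
  simp [encCols]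

theorem encCols_append (L L' : List (Column × SignType)) :
    encCols (L ++ L') = encCols L ++ encCols L' := by
  simp [encCols]

theorem ket_notMem_encCol (m : SignType) (X : Column) : ket m ∉ encCol X := by
  simp [encCol]

/-- Each row gains at most one symbol from the final carry, and the second copy of `X` pays for it.
The coefficient of `Y` is `1`, so repeated addition into an accumulator grows additively, not
exponentially. -/
theorem length_encCol_colAdd : ∀ X Y : Column, Y.length ≤ X.length →
    (encCol (colAdd X Y)).length ≤ 2 * (encCol X).length + (encCol Y).length
  | [], _, _ => by simp [colAdd]
  | x :: X, [], _ => by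
    have := length_encCol_colAdd X [] (by simp)
    have := length_rowAdd_le 0 x []
    simp [colAdd] at *
    omega
  | x :: X, y :: Y, h => by
    have := length_encCol_colAdd X Y (by simpa using h)
    have := length_rowAdd_le 0 x y
    simp [colAdd] at *
    omega

/-- Multiplication of a digit by a sign. -/
def scaleLetter (m : SignType) : Letter → Letter
  | dig s => dig (m * s)
  | a => a

theorem map_scaleLetter_encCol (m : SignType) (X : Column) :
    (encCol X).map (scaleLetter m) = encCol (colSMul m X) := by
  induction X with
  | nil => rfl
  | cons x X ih =>
    simp only [colSMul, List.map_cons, encCol_cons, List.map_append, scaleLetter] at *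
    simp [ih, scaleLetter]

@[simp]
theorem length_encCol_colSMul (m : SignType) (X : Column) :
    (encCol (colSMul m X)).length = (encCol X).length := by
  rw [← map_scaleLetter_encCol, List.length_map]

end QCommute

/-! ### Programs that sum marked columns and test the sum for zero. -/

namespace QCommute

open Turing Function Prog
open Computability (Γ')

/-! ### The programs -/

/-- The stacks of the decision program. -/
inductive Stk (k : ℕ) : Type
  | src
  | flag
  | tmp
  | carry
  | acc
  | col
  | res
  | inp (t : Fin (k + 1))
  | seen (t : Fin (k + 1))
  deriving DecidableEq, Fintype

open Letter Stk

variable {k : ℕ}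

/-- Output the digit of a sum and keep the carry. -/
def emit (v : ℤ) : Prog (Stk k) Letter :=
  seq (push res (dig (digitOut v))) (push carry (dig (carryOut v)))

/-- The digit held by a symbol. -/
def digitOf : Option Letter → SignType
  | some (dig s) => s
  | _ => 0

/-- One step of the addition of the columns on `tmp` and `acc`, for the symbol `a` of the first,
the symbol `e` of the second, and the carry `c`. -/
def addStep (c : SignType) : Letter → Option Letter → Prog (Stk k) Letter
  | dig x, some (dig y) => emit (x + y + c)
  | dig x, some e => seq (push acc e) (emit (x + c))
  | dig x, none => emit (x + c)
  | _, some (dig y) => seq (push tmp comma) (emit (y + c))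
  | _, _ => seq (push res (dig c)) (seq (push res comma) (push carry (dig 0)))

/-- Add the columns on `tmp` and `acc`, with the result in reverse on `res`. -/
def addLoop : Prog (Stk k) Letter :=
  loop tmp fun a => pop carry fun c => pop acc fun e => addStep (digitOf c) a e

theorem addLoop_step {S S₁ S' : Stk k → List Letter} {a : Letter} {l : List Letter} {c : SignType}
    {e : Option Letter} {A : List Letter} {n j : ℕ} (htmp : S tmp = a :: l)
    (hcarry : S carry = [dig c]) (he : (S acc).head? = e) (hA : (S acc).tail = A)
    (h : (addStep c a e).Run (update (update (update S tmp l) carry []) acc A) S₁ j) (hj : j ≤ 3)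
    (h' : addLoop.Run S₁ S' n) : addLoop.Run S S' (n + 6) := by
  refine (Run.loop_cons (n := 5) (n' := n) htmp (Run.mono (n := j + 1 + 1) (.pop (.pop ?_)) ?_)
    h').mono (by omega)
  · subst he hA
    simpa [hcarry, digitOf] using h
  · omega

theorem run_emit (v : ℤ) (S : Stk k → List Letter) :
    (emit v).Run S (update (update S res (dig (digitOut v) :: S res)) carry
      (dig (carryOut v) :: S carry)) 2 :=
  (Run.seq (.push ..) (.push ..)).congr (by simp) le_rfl

/-- Stated with a continuation, since one loop runs through all rows: a run from the state after
this row extends to one from the state before it. `A` does not start with a digit, so `y` is the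
whole row; `A.tail` drops its separator, if there is one. -/
theorem run_addLoop_row (c : SignType) (x y : List SignType) :
    ∀ {S S' : Stk k → List Letter} {n : ℕ} {T A : List Letter}, S tmp = x.map dig ++ comma :: T →
      S acc = y.map dig ++ A → (∀ s, A.head? ≠ some (dig s)) → S carry = [dig c] →
      addLoop.Run (update (update (update (update S tmp T) acc A.tail) carry [dig 0]) res
        (comma :: ((rowAdd c x y).map dig).reverse ++ S res)) S' n →
      addLoop.Run S S' (n + 6 * (x.length + y.length + 1)) := by
  induction c, x, y using rowAdd.induct with
  | case1 c x xs y ys ih =>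
    intro S S' n T A h1 h2 hA h3 h
    refine (addLoop_step (e := some (dig y)) (A := ys.map dig ++ A) h1 h3 (by rw [h2]; rfl)
      (by rw [h2]; rfl) (run_emit _ _) (by omega)
      (ih (n := n) (T := T) (A := A) ?_ ?_ hA ?_ ?_)).mono ?_
    · simp
    · simp
    · simp
    · convert h using 1
      funext z
      simp only [update_apply, rowAdd]
      split_ifs <;> simp_all
    · simp; omega
  | case2 c x xs ih =>
    intro S S' n T A h1 h2 hA h3 h
    rcases A with _ | ⟨a, A⟩
    · refine (addLoop_step (e := none) (A := []) h1 h3 (by rw [h2]; rfl) (by rw [h2]; rfl)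
        (run_emit _ _) (by omega)
        (ih (n := n) (T := T) (A := []) ?_ ?_ hA ?_ ?_)).mono ?_
      · simp
      · simp
      · simp
      · convert h using 1
        funext z
        simp only [update_apply, rowAdd]
        split_ifs <;> simp_all
      · simp; omega
    · have hstep : addStep (k := k) c (dig x) (some a) = seq (push acc a) (emit (x + c)) := by
        cases a <;> simp_all [addStep]
      refine (addLoop_step (e := some a) (A := A) h1 h3 (by rw [h2]; rfl) (by rw [h2]; rfl)
        (by rw [hstep]; exact .seq (.push ..) (run_emit _ _)) (by omega)
        (ih (n := n) (T := T) (A := a :: A) ?_ ?_ hA ?_ ?_)).mono ?_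
      · simp
      · simp
      · simp
      · convert h using 1
        funext z
        simp only [update_apply, rowAdd]
        split_ifs <;> simp_all
      · simp; omega
  | case3 c y ys ih =>
    intro S S' n T A h1 h2 hA h3 h
    refine (addLoop_step (e := some (dig y)) (A := ys.map dig ++ A) h1 h3 (by rw [h2]; rfl)
      (by rw [h2]; rfl) (.seq (.push ..) (run_emit _ _)) (by omega)
      (ih (n := n) (T := T) (A := A) ?_ ?_ hA ?_ ?_)).mono ?_
    · simp
    · simp
    · simp
    · convert h using 1
      funext z
      simp only [update_apply, rowAdd]
      split_ifs <;> simp_all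
    · simp; omega
  | case4 c =>
    intro S S' n T A h1 h2 hA h3 h
    have hstep : addStep (k := k) c comma A.head? =
        seq (push res (dig c)) (seq (push res comma) (push carry (dig 0))) := by
      rcases A with _ | ⟨a, A⟩
      · rfl
      · cases a <;> simp_all [addStep]
    refine (addLoop_step (e := A.head?) (A := A.tail) h1 h3 (by rw [h2]; rfl) (by rw [h2]; rfl)
      (by rw [hstep]; exact .seq (.push ..) (.seq (.push ..) (.push ..))) (by omega)
      (n := n) ?_).mono ?_
    · convert h using 1
      funext z
      simp only [update_apply, rowAdd]
      split_ifs <;> simp_all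
    · simp

theorem run_addLoop : ∀ (X Y : Column) {S : Stk k → List Letter}, Y.length ≤ X.length →
    S tmp = encCol X → S acc = encCol Y → S carry = [dig 0] →
    addLoop.Run S (update (update (update S tmp []) acc []) res
      ((encCol (colAdd X Y)).reverse ++ S res))
      (6 * ((encCol X).length + (encCol Y).length) + 1)
  | [], [], S, _, h1, h2, h3 => by
    refine (Run.loop_nil h1).congr ?_ (by simp)
    funext z
    simp only [update_apply]
    split_ifs <;> simp_all [colAdd]
  | x :: X, Y, S, hl, h1, h2, h3 => by
    rw [encCol_cons] at h1
    -- Rows missing from `Y` are read as empty rows; this covers the initially empty accumulator.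
    have h2' : S acc = (Y.headD []).map dig ++ (encCol Y).drop (Y.headD []).length := by
      rw [h2]; cases Y <;> simp
    refine (run_addLoop_row 0 x (Y.headD []) h1 h2' ?_ h3
      (run_addLoop X Y.tail ?_ ?_ ?_ ?_)).congr ?_ ?_
    · cases Y <;> simp
    · simp at hl ⊢; omega
    · simp
    · cases Y <;> simp
    · simp
    · funext z
      simp only [update_apply]
      split_ifs <;> simp_all [colAdd]
    · cases Y <;> simp <;> omega

/-- Add the column on `col`, multiplied by `m`, to the one on `acc`. -/
def addCol (m : SignType) : Prog (Stk k) Letter :=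
  seq (loop col fun x => push tmp (scaleLetter m x)) <| seq (push carry (dig 0)) <|
    seq addLoop <| seq (pop carry fun _ => skip) (loop res fun x => push acc (id x))

/-- The column arrives reversed on `col`; moving it to `tmp` restores its order and applies the sign
on the way. The sum appears reversed on `res`, and moving it to `acc` undoes this. -/
theorem run_addCol (m : SignType) (X Y : Column) {S : Stk k → List Letter}
    (hl : Y.length ≤ X.length) (hcol : S col = (encCol X).reverse) (hacc : S acc = encCol Y)
    (htmp : S tmp = []) (hcarry : S carry = []) (hres : S res = []) :
    (addCol m).Run S (update (update S col []) acc (encCol (colAdd (colSMul m X) Y)))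
      (12 * (encCol X).length + 8 * (encCol Y).length + 6) := by
  have hlen := length_encCol_colAdd (colSMul m X) Y (by simpa using hl)
  rw [length_encCol_colSMul] at hlen
  refine (Run.seq (run_move (by simp) _ _ _ hcol) <| .seq (.push ..) <|
    .seq (run_addLoop (colSMul m X) Y (by simpa using hl) ?_ ?_ ?_) <|
    .seq (.pop (.skip _)) (run_move (by simp) _ (encCol (colAdd (colSMul m X) Y)).reverse _ ?_)).congr
    ?_ ?_
  · simp [htmp, map_scaleLetter_encCol]
  · simp [hacc]
  · simp [hcarry]
  · simp [hres]
  · funext z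
    simp only [update_apply]
    split_ifs <;> simp_all
  · simp
    omega

/-- Sum up the marked columns on a stack. -/
def sumLoop (i : Stk k) : Prog (Stk k) Letter :=
  loop i fun a => match a with
    | ket m => addCol m
    | a => push col a

theorem run_sumLoop_col {i : Stk k} (hi : i ≠ col) : ∀ (l : List Letter) {S S' : Stk k → List Letter}
    {T : List Letter} {n : ℕ}, (∀ m, ket m ∉ l) → S i = l ++ T →
    (sumLoop i).Run (update (update S i T) col (l.reverse ++ S col)) S' n →
    (sumLoop i).Run S S' (n + 2 * l.length)
  | [], S, S', T, n, _, h, hr => by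
    refine Run.mono (n := n) ?_ (by simp)
    convert hr using 1
    funext z
    simp only [update_apply]
    split_ifs <;> simp_all
  | a :: l, S, S', T, n, hl, h, hr => by
    refine (Run.loop_cons (n := 1) (S' := update (update S i (l ++ T)) col (a :: S col)) h ?_
      (run_sumLoop_col hi l (T := T) (n := n) ?_ ?_ ?_)).mono ?_
    · rcases a with _ | _ | _ | m
      · exact (Run.push ..).congr (by simp [hi.symm]) le_rfl
      · exact (Run.push ..).congr (by simp [hi.symm]) le_rfl
      · exact (Run.push ..).congr (by simp [hi.symm]) le_rfl
      · exact absurd (List.mem_cons_self ..) (hl m)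
    · exact fun m hm => hl m (List.mem_cons_of_mem _ hm)
    · simp [hi]
    · convert hr using 1
      funext z
      simp only [update_apply]
      split_ifs <;> simp_all
    · simp; omega

/-- The quantity `|Y| + 2 |L|`, in string lengths, never increases: by `length_encCol_colAdd`,
absorbing a column lengthens the accumulator by at most twice that column. So `B` bounds every
partial sum, and each addition costs linear time in `B`. -/
theorem run_sumLoop {t : Fin (k + 1)} {r B : ℕ} : ∀ (L : List (Column × SignType)) (Y : Column)
    {S : Stk k → List Letter}, (∀ c ∈ L, c.1.length = r) → Y.length ≤ r →
    S (inp t) = encCols L → S acc = encCol Y → S col = [] → S tmp = [] → S carry = [] →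
    S res = [] → (encCol Y).length + 2 * (encCols L).length ≤ B →
    (sumLoop (inp t)).Run S (update (update S (inp t) []) acc (encCol (total L Y)))
      ((encCols L).length * (8 * B + 14) + 1) ∧
      (encCol (total L Y)).length ≤ B
  | [], Y, S, _, _, h1, h2, _, _, _, _, hB => by
    refine ⟨(Run.loop_nil h1).congr ?_ (by simp), by simpa [total] using hB⟩
    funext z
    simp only [update_apply]
    split_ifs <;> simp_all [total]
  | (X, m) :: L, Y, S, hr, hY, h1, h2, h3, h4, h5, h6, hB => by
    have hX : X.length = r := hr (X, m) List.mem_cons_self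
    have hlen := length_encCol_colAdd (colSMul m X) Y (by simp; omega)
    rw [length_encCol_colSMul] at hlen
    simp only [encCols_cons, List.length_append, List.length_cons] at hB h1
    have ih := run_sumLoop (B := B) (t := t) L (colAdd (colSMul m X) Y)
      (S := update (update S (inp t) (encCols L)) acc (encCol (colAdd (colSMul m X) Y)))
      (fun c hc => hr c (List.mem_cons_of_mem _ hc)) (by simp [hX]) (by simp) (by simp)
      (by simp [h3]) (by simp [h4]) (by simp [h5]) (by simp [h6]) (by omega)
    refine ⟨(run_sumLoop_col (by simp) _ (ket_notMem_encCol · X) h1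
      (Run.loop_cons (a := ket m) (l := encCols L) ?_
        (S'' := update (update S (inp t) []) acc (encCol (total L (colAdd (colSMul m X) Y))))
        (n' := (encCols L).length * (8 * B + 14) + 1)
        (run_addCol m X Y (by omega) ?_ ?_ ?_ ?_ ?_) ?_)).congr ?_ ?_, ?_⟩
    · simp
    · simp [h3]
    · simp [h2]
    · simp [h4]
    · simp [h5]
    · simp [h6]
    · convert ih.1 using 1
      · rfl
      · funext z
        simp only [update_apply]
        split_ifs <;> simp_all
      · funext z
        simp only [update_apply]
        split_ifs <;> simp_all
    · simp [total]
    · simp only [encCols_cons, List.length_append, List.length_cons]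
      nlinarith
    · simpa [total] using ih.2

/-- A stack holding a truth value. -/
def bit (b : Bool) : List Letter :=
  if b then [dig 1] else []

/-- Record the answer `true`. -/
def accept : Prog (Stk k) Letter :=
  pop flag fun _ => push flag (dig 1)

theorem run_accept {b : Bool} {S : Stk k → List Letter} (h : S flag = bit b) :
    accept.Run S (update S flag (bit true)) 2 :=
  (Run.pop (.push ..)).congr (by cases b <;> simp [h, bit]) le_rfl

/-- Whether all digits in a string are zero. -/
def zeroDigits (l : List Letter) : Bool :=
  l.all fun a => digitOf (some a) = 0

/-- Test whether all digits on `acc` are zero. -/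
def zeroTest : Prog (Stk k) Letter :=
  seq (push carry (dig 1)) <|
    seq (loop acc fun a => if digitOf (some a) = 0 then skip else pop carry fun _ => skip) <|
    pop carry fun o => if o.isSome then accept else skip

/-- Here `carry` serves as a flag, nonempty as long as only zero digits have been seen. -/
theorem run_zeroTest_loop : ∀ (l : List Letter) {S : Stk k → List Letter} {b : Bool}, S acc = l →
    S carry = bit b →
    (loop acc fun a => if digitOf (some a) = 0 then skip else pop carry fun _ => skip :
      Prog (Stk k) Letter).Run S
      (update (update S acc []) carry (bit (b && zeroDigits l))) (3 * l.length + 1)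
  | [], S, b, h, hb => by
    refine (Run.loop_nil h).congr ?_ (by simp)
    funext z
    simp only [update_apply]
    split_ifs <;> simp_all [zeroDigits]
  | a :: l, S, b, h, hb => by
    by_cases ha : digitOf (some a) = 0
    · refine (Run.loop_cons h (by rw [if_pos ha]; exact .skip _)
        (run_zeroTest_loop l (b := b) (by simp) (by simp [hb]))).congr ?_ (by simp; omega)
      simp [zeroDigits, ha]
    -- Popping lowers the flag; if it is already down, popping an empty stack does nothing.
    · refine (Run.loop_cons h (by rw [if_neg ha]; exact .pop (.skip _))
        (run_zeroTest_loop l (b := false) (by simp) (by cases b <;> simp [hb, bit]))).congr ?_ ?_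
      · funext z
        simp only [update_apply]
        split_ifs <;> simp_all [zeroDigits]
      · simp; omega

theorem run_zeroTest {S : Stk k → List Letter} {b : Bool} (hcarry : S carry = [])
    (hflag : S flag = bit b) : zeroTest.Run S
      (update (update S acc []) flag (bit (b || zeroDigits (S acc)))) (3 * (S acc).length + 5) := by
  have h1 := run_zeroTest_loop (S acc) (S := update S carry [dig 1]) (b := true) (by simp)
    (by simp [bit])
  cases hz : zeroDigits (S acc)
  · refine (Run.seq (.push ..) <| .seq (by rw [hcarry]; exact h1) <|
      .pop (by simp [hz, bit]; exact .skip _)).congr ?_ (by omega)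
    funext z
    simp only [update_apply]
    split_ifs <;> simp_all [bit]
  · refine (Run.seq (.push ..) <| .seq (by rw [hcarry]; exact h1) <|
      .pop (by simp [hz, bit]; exact run_accept (b := b) (by simp [hflag]))).congr ?_ (by omega)
    funext z
    simp only [update_apply]
    split_ifs <;> simp_all [bit]

end QCommute

/-! ### Exhaustive search over the marks. -/

namespace QCommute

open Turing Function Prog Letter Stk
open Computability (Γ')

variable {k : ℕ}

theorem zeroDigits_encCol (X : Column) :
    zeroDigits (encCol X) = true ↔ ∀ i < X.length, colVal X i = 0 := by
  have h1 : zeroDigits (encCol X) = true ↔ ∀ x ∈ X, ∀ d ∈ x, d = 0 := by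
    simp only [zeroDigits, encCol, List.all_eq_true, List.mem_flatMap]
    constructor
    · intro h x hx d hd
      exact of_decide_eq_true (h (dig d) ⟨x, hx, by simp [hd]⟩)
    · rintro h a ⟨x, hx, ha⟩
      simp only [List.mem_append, List.mem_map, List.mem_singleton] at ha
      rcases ha with ⟨d, hd, rfl⟩ | rfl
      · exact decide_eq_true (h x hx d hd)
      · simp [digitOf]
  have h2 : (∀ x ∈ X, ∀ d ∈ x, d = 0) ↔ ∀ x ∈ X, rowVal x = 0 :=
    forall₂_congr fun x _ => (rowVal_eq_zero_iff x).symm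
  rw [h1, h2, List.forall_mem_iff_getElem]
  refine forall₂_congr fun i hi => ?_
  simp [colVal, hi]

/-! ### The search over marks -/

/-- `Reachable t L`: by setting `t` marks in the list `L` of marked columns to `1` or `-1` one can
make the sum of the columns, each one multiplied by its mark, zero. -/
def Reachable : ℕ → List (Column × SignType) → Prop
  | 0, L => zeroDigits (encCol (total L [])) = true
  | t + 1, L => ∃ pre X s post, L = pre ++ (X, s) :: post ∧
      (Reachable t (pre ++ (X, 1) :: post) ∨ Reachable t (pre ++ (X, -1) :: post))

/-- Run `p` on the string obtained by inserting `ket m` between the contents of `l`, reversed,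
and those of `i`. -/
def tryMark (i j : Stk k) (l : Stk k) (p : Prog (Stk k) Letter) (m : SignType) :
    Prog (Stk k) Letter :=
  seq (loop i fun x => push tmp (id x)) <| seq (loop tmp fun x => seq (push i x) (push j x)) <|
    seq (push j (ket m)) <| seq (loop l fun x => seq (push j x) (push tmp x)) <|
    seq (loop tmp fun x => push l (id x)) p

/-- Run `p` on all strings obtained by setting one mark of the string on `i`, moving it to `l`. -/
def markLoop (i j l : Stk k) (p : Prog (Stk k) Letter) : Prog (Stk k) Letter :=
  loop i fun a => seq
    (match a with
      | ket _ => seq (tryMark i j l p 1) (tryMark i j l p (-1))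
      | _ => skip)
    (push l a)

/-- The program deciding `Reachable t` for the marked columns on `inp t`. -/
def search : (t : ℕ) → t < k + 1 → Prog (Stk k) Letter
  | 0, h => seq (sumLoop (inp ⟨0, h⟩)) zeroTest
  | t + 1, h => seq
    (markLoop (inp ⟨t + 1, h⟩) (inp ⟨t, by omega⟩) (seen ⟨t, by omega⟩) (search t (by omega)))
    (loop (seen ⟨t, by omega⟩) fun _ => skip)

/-- The running time of `search`, for an input of length `N`. -/
def searchTime (N : ℕ) : ℕ → ℕ
  | 0 => N * (16 * N + 14) + 6 * N + 6
  | t + 1 => N * (2 * searchTime N t + 10 * N + 15) + 2 * N + 2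

/-- The stacks used by `search t` besides `inp t` and `flag` are empty. -/
structure Clean (t : ℕ) (S : Stk k → List Letter) : Prop where
  tmp : S tmp = []
  carry : S carry = []
  acc : S acc = []
  col : S col = []
  res : S res = []
  inp : ∀ i : Fin (k + 1), i.1 < t → S (inp i) = []
  seen : ∀ i : Fin (k + 1), i.1 < t → S (seen i) = []

open Classical in
theorem run_search_zero (h : 0 < k + 1) {r N : ℕ} {L : List (Column × SignType)}
    {S : Stk k → List Letter} {b : Bool} (hr : ∀ c ∈ L, c.1.length = r) (hS : Clean 0 S)
    (hL : S (inp ⟨0, h⟩) = encCols L) (hN : (encCols L).length ≤ N) (hb : S flag = bit b) :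
    (search 0 h).Run S (update (update S (inp ⟨0, h⟩) []) flag (bit (b || decide (Reachable 0 L))))
      (searchTime N 0) := by
  -- The accumulator starts empty, so the budget `B` is twice the input length.
  obtain ⟨h1, h2⟩ := run_sumLoop (t := ⟨0, h⟩) (B := 2 * N) L [] hr (by simp) hL (by simp [hS.acc])
    hS.col hS.tmp hS.carry hS.res (by simp; omega)
  refine (h1.seq (run_zeroTest (b := b) (by simp [hS.carry]) (by simp [hb]))).congr ?_ ?_
  · have := hS.acc
    have hd : decide (Reachable 0 L) = zeroDigits (encCol (total L [])) := by
      rw [Bool.eq_iff_iff, decide_eq_true_iff, Reachable]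
    rw [hd]
    funext z
    simp only [update_apply]
    split_ifs <;> simp_all
  · simp only [update_self, searchTime]
    have : (encCols L).length * (8 * (2 * N) + 14) ≤ N * (16 * N + 14) :=
      Nat.mul_le_mul hN (by omega)
    omega

/-- Both `i` and `l` are copied to `j` through `tmp` and restored. Each symbol is moved once (two
steps) and moved with duplication once (three steps), whence `5 * N`. -/
theorem run_tryMark {i j l : Stk k} (hij : i ≠ j) (hil : i ≠ l) (hjl : j ≠ l) (hi : tmp ≠ i)
    (hj : tmp ≠ j) (hl : tmp ≠ l) {p : Prog (Stk k) Letter} {m : SignType}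
    {S S' : Stk k → List Letter} {n N : ℕ} (htmp : S tmp = []) (hSj : S j = [])
    (hN : (S i).length + (S l).length ≤ N)
    (h : p.Run (update S j ((S l).reverse ++ ket m :: S i)) S' n) :
    (tryMark i j l p m).Run S S' (n + 5 * N + 5) := by
  refine (Run.seq (run_move hi.symm _ _ _ rfl) <|
    .seq (run_move_both hi hj hij (S i).reverse _ ?_) <| .seq (.push ..) <|
    .seq (run_move_both hjl.symm hl.symm hj.symm (S l) _ ?_) <|
    .seq (S' := update S j ((S l).reverse ++ ket m :: S i))
      ((run_move hl _ (S l).reverse _ ?_).congr ?_ le_rfl) h).mono ?_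
  · simp [htmp]
  · simp [hjl.symm, hl.symm, hil.symm]
  · simp [hj, hi]
  · funext z
    simp only [update_apply]
    split_ifs <;> simp_all
  · simp
    omega

theorem run_markLoop_col {i j l : Stk k} (hil : i ≠ l) {p : Prog (Stk k) Letter} :
    ∀ (w : List Letter) {S S' : Stk k → List Letter} {T : List Letter} {n : ℕ}, (∀ m, ket m ∉ w) →
    S i = w ++ T →
    (markLoop i j l p).Run (update (update S i T) l (w.reverse ++ S l)) S' n →
    (markLoop i j l p).Run S S' (n + 3 * w.length)
  | [], S, S', T, n, _, h, hr => by
    refine Run.mono (n := n) ?_ (by simp)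
    convert hr using 1
    funext z
    simp only [update_apply]
    split_ifs <;> simp_all
  | a :: w, S, S', T, n, hw, h, hr => by
    refine (Run.loop_cons (n := 2) (S' := update (update S i (w ++ T)) l (a :: S l)) h ?_
      (run_markLoop_col hil w (T := T) (n := n) ?_ ?_ ?_)).mono ?_
    · refine (Run.seq (n := 1) (n' := 1) (S' := update S i (w ++ T)) ?_ (.push ..)).congr ?_ le_rfl
      · rcases a with _ | _ | _ | m
        · exact .skip _
        · exact .skip _
        · exact .skip _
        · exact absurd (List.mem_cons_self ..) (hw m)
      · simp [hil.symm]
    · exact fun m hm => hw m (List.mem_cons_of_mem _ hm)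
    · simp [hil]
    · convert hr using 1
      funext z
      simp only [update_apply]
      split_ifs <;> simp_all
    · simp; omega

/-- Separates the choice of the column whose mark is changed: either it is the head, or it lies in
the tail. -/
theorem exists_split_cons {Q : List (Column × SignType) → Prop}
    {pre post : List (Column × SignType)} {X : Column} {s : SignType} :
    (∃ pre' X' s' post', (X, s) :: post = pre' ++ (X', s') :: post' ∧
        (Q (pre ++ pre' ++ (X', 1) :: post') ∨ Q (pre ++ pre' ++ (X', -1) :: post'))) ↔
      Q (pre ++ (X, 1) :: post) ∨ Q (pre ++ (X, -1) :: post) ∨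
      ∃ pre' X' s' post', post = pre' ++ (X', s') :: post' ∧
        (Q (pre ++ [(X, s)] ++ pre' ++ (X', 1) :: post') ∨
          Q (pre ++ [(X, s)] ++ pre' ++ (X', -1) :: post')) := by
  constructor
  · rintro ⟨_ | ⟨c, pre'⟩, X', s', post', h, h'⟩
    · simp only [List.nil_append, List.cons.injEq, Prod.mk.injEq] at h
      obtain ⟨⟨rfl, rfl⟩, rfl⟩ := h
      simpa [or_assoc] using Or.imp_right Or.inl h'
    · simp only [List.cons_append, List.cons.injEq] at h
      obtain ⟨rfl, rfl⟩ := h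
      exact .inr (.inr ⟨pre', X', s', post', rfl, by simpa using h'⟩)
  · rintro (h | h | ⟨pre', X', s', post', rfl, h⟩)
    · exact ⟨[], X, s, post, rfl, .inl (by simpa using h)⟩
    · exact ⟨[], X, s, post, rfl, .inr (by simpa using h)⟩
    · exact ⟨(X, s) :: pre', X', s', post', rfl, by simpa using h⟩

-- Loop invariant: `i` holds the columns still to be visited and `l` the visited ones, reversed,
-- with their original marks. `P` abstracts the state that `p` needs and `Q` what it decides, so the
-- same lemma serves every level of the search.
open Classical in
theorem run_markLoop {i j l : Stk k} (hij : i ≠ j) (hil : i ≠ l) (hjl : j ≠ l) (hi : tmp ≠ i)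
    (hj : tmp ≠ j) (hl : tmp ≠ l) (hfi : flag ≠ i) (hfj : flag ≠ j) (hfl : flag ≠ l)
    {p : Prog (Stk k) Letter} {P : (Stk k → List Letter) → Prop}
    (hP : ∀ S S', (∀ z, z ≠ i → z ≠ j → z ≠ l → z ≠ flag → S z = S' z) → P S → P S')
    (hPtmp : ∀ S, P S → S tmp = []) {Q : List (Column × SignType) → Prop} {r N n : ℕ}
    (hp : ∀ L S b, (∀ c ∈ L, c.1.length = r) → P S → S j = encCols L → (encCols L).length ≤ N →
      S flag = bit b → p.Run S (update (update S j []) flag (bit (b || decide (Q L)))) n) :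
    ∀ (post pre : List (Column × SignType)) {S : Stk k → List Letter} {b : Bool},
      (∀ c ∈ pre ++ post, c.1.length = r) → P S → S j = [] → S i = encCols post →
      S l = (encCols pre).reverse → (encCols (pre ++ post)).length ≤ N → S flag = bit b →
      (markLoop i j l p).Run S
        (update (update (update S i []) l (encCols (pre ++ post)).reverse) flag
          (bit (b || decide (∃ pre' X s post', post = pre' ++ (X, s) :: post' ∧
            (Q (pre ++ pre' ++ (X, 1) :: post') ∨ Q (pre ++ pre' ++ (X, -1) :: post'))))))
        ((encCols post).length * (2 * n + 10 * N + 15) + 1)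
  | [], pre, S, b, _, _, _, h1, h2, _, h3 => by
    refine (Run.loop_nil h1).congr ?_ (by simp)
    funext z
    simp only [update_apply]
    split_ifs <;> simp_all
  | (X, s) :: post, pre, S, b, hr, hPS, hSj, h1, h2, hN, h3 => by
    have hr' : ∀ m, ∀ c ∈ pre ++ (X, m) :: post, c.1.length = r := by
      intro m c hc
      rw [List.mem_append, List.mem_cons] at hc
      rcases hc with hc | rfl | hc
      · exact hr c (by simp [hc])
      · exact hr (X, s) (by simp)
      · exact hr c (by simp [hc])
    have henc : ∀ m, encCols (pre ++ (X, m) :: post) =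
        encCols pre ++ encCol X ++ ket m :: encCols post := by
      simp [encCols_append]
    have hN' : ∀ m, (encCols (pre ++ (X, m) :: post)).length ≤ N := by
      intro m
      rw [henc] at hN ⊢
      simpa using hN
    have hlen : (encCols pre).length + (encCol X).length + (encCols post).length ≤ N := by
      rw [henc] at hN
      simp at hN
      omega
    have htmp := hPtmp S hPS
    have tmp_ne_flag : (tmp : Stk k) ≠ flag := by simp
    rw [encCols_cons] at h1
    refine (run_markLoop_col hil _ (ket_notMem_encCol · X) h1 (Run.loop_cons (a := ket s)
      (l := encCols post) ?_ (Run.seq (Run.seq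
        (run_tryMark (N := N) hij hil hjl hi hj hl ?_ ?_ ?_
          (hp (pre ++ (X, 1) :: post) _ b (hr' _) ?_ ?_ (hN' _) ?_))
        (run_tryMark (N := N) hij hil hjl hi hj hl ?_ ?_ ?_
          (hp (pre ++ (X, -1) :: post) _ (b || decide (Q (pre ++ (X, 1) :: post)))
            (hr' _) ?_ ?_ (hN' _) ?_)))
        (.push ..))
      (run_markLoop hij hil hjl hi hj hl hfi hfj hfl hP hPtmp hp post (pre ++ [(X, s)])
        (b := b || decide (Q (pre ++ (X, 1) :: post)) || decide (Q (pre ++ (X, -1) :: post)))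
        (by simpa using hr) ?_ ?_ ?_ ?_ (by simpa using hN) ?_))).congr ?_ ?_
    · simp [hil]
    · simp [hi, hl, htmp]
    · simp [hij.symm, hjl, hSj]
    · simpa [hil, hil.symm, h2, henc, add_comm, add_left_comm, add_assoc] using hlen
    · refine hP S _ (fun z z1 z2 z3 z4 => ?_) hPS
      simp [z1, z2, z3]
    · simp [hil.symm, h2, henc]
    · simp [hfi, hfj, hfl, h3]
    · simp [hi, hj, hl, htmp, tmp_ne_flag]
    · simp [hfj.symm]
    · simpa [hil, hil.symm, hij, hjl.symm, hfi.symm, hfl.symm, h2, henc, add_comm, add_left_comm,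
        add_assoc] using hlen
    · refine hP S _ (fun z z1 z2 z3 z4 => ?_) hPS
      simp [z1, z2, z3, z4]
    · simp [hil.symm, hij, hjl.symm, hfi.symm, hfl.symm, h2, henc]
    · simp [hfj]
    · refine hP S _ (fun z z1 z2 z3 z4 => ?_) hPS
      simp [z1, z2, z3, z4]
    · simp [hjl, hfj.symm]
    · simp [hil, hij, hfi.symm]
    · simp [hil.symm, hjl.symm, hfl.symm, h2, encCols_append]
    · simp [hfl]
    · funext z
      by_cases z1 : z = flag
      · simp only [exists_split_cons, Bool.decide_or, z1, update_self, Bool.or_assoc]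
      by_cases z2 : z = l
      · simp [z2, hfl.symm]
      by_cases z3 : z = i
      · simp [z3, hil, hfi.symm]
      by_cases z4 : z = j
      · simp [z4, hjl, hij.symm, hfj.symm, hSj]
      · simp [z1, z2, z3, z4]
    · simp only [encCols_cons, List.length_append, List.length_cons]
      nlinarith

-- Level `t + 1` is a mark loop around level `t`; the visited columns left on `seen` are then
-- cleared, so each call restores the stacks that the next one expects to be empty.
open Classical in
theorem run_search {r N : ℕ} : ∀ (t : ℕ) (h : t < k + 1) (L : List (Column × SignType))
    (S : Stk k → List Letter) (b : Bool), (∀ c ∈ L, c.1.length = r) → Clean t S →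
    S (inp ⟨t, h⟩) = encCols L → (encCols L).length ≤ N → S flag = bit b →
    (search t h).Run S (update (update S (inp ⟨t, h⟩) []) flag (bit (b || decide (Reachable t L))))
      (searchTime N t)
  | 0, h, _, _, _, hr, hS, hL, hN, hb => run_search_zero h hr hS hL hN hb
  | t + 1, h, L, S, b, hr, hS, hL, hN, hb => by
    have hseen := hS.seen ⟨t, by omega⟩ (by simp)
    have hloop := run_markLoop (i := inp ⟨t + 1, h⟩) (j := inp ⟨t, by omega⟩)
      (l := seen ⟨t, by omega⟩) (by simp) (by simp) (by simp) (by simp) (by simp) (by simp)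
      (by simp) (by simp) (by simp) (p := search t (by omega)) (P := Clean t)
      (fun S S' hSS' hS => ⟨?_, ?_, ?_, ?_, ?_, ?_, ?_⟩)
      (fun S hS => hS.tmp) (run_search (r := r) (N := N) t (by omega))
      L [] (S := S) (b := b) (by simpa using hr) ⟨hS.tmp, hS.carry, hS.acc, hS.col, hS.res,
        fun i hi => hS.inp i (by omega), fun i hi => hS.seen i (by omega)⟩
      (hS.inp _ (by simp)) hL (by simp [hseen]) (by simpa using hN) hb
    · refine (hloop.seq (run_clear _ _ _ rfl)).congr ?_ ?_
      · funext z
        by_cases z1 : z = seen ⟨t, by omega⟩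
        · simp [z1, hseen]
        by_cases z2 : z = flag
        · simp only [z2, Reachable, List.nil_append, update_self]
          simp only [ne_eq, reduceCtorEq, not_false_eq_true, update_of_ne, update_self]
          congr
        by_cases z3 : z = inp ⟨t + 1, h⟩
        · simp [z3]
        · simp [z1, z2, z3]
      · have : (encCols L).length * (2 * searchTime N t + 10 * N + 15) ≤
            N * (2 * searchTime N t + 10 * N + 15) := Nat.mul_le_mul_right _ hN
        simp [searchTime]
        omega
    · rw [← hSS' tmp (by simp) (by simp) (by simp) (by simp), hS.tmp]
    · rw [← hSS' carry (by simp) (by simp) (by simp) (by simp), hS.carry]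
    · rw [← hSS' acc (by simp) (by simp) (by simp) (by simp), hS.acc]
    · rw [← hSS' col (by simp) (by simp) (by simp) (by simp), hS.col]
    · rw [← hSS' res (by simp) (by simp) (by simp) (by simp), hS.res]
    · intro i hi
      rw [← hSS' (inp i) (by simp [Fin.ext_iff]; omega) (by simp [Fin.ext_iff]; omega) (by simp)
        (by simp), hS.inp i hi]
    · intro i hi
      rw [← hSS' (seen i) (by simp) (by simp) (by simp [Fin.ext_iff]; omega) (by simp), hS.seen i hi]

end QCommute

/-! ### Translation of the raw input, and the complete decision program. -/

namespace QCommute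

open Turing Function Prog Letter Stk
open Computability (Γ' encodeNat encodeNum encodePosNum)

variable {k : ℕ}

/-! ### Normalisation of the input -/

/-- The signed binary digits of an integer. -/
def intDigits (z : ℤ) : List SignType :=
  (encodeNat z.natAbs).map fun b => if b then (if z < 0 then -1 else 1) else 0

theorem rowVal_map_encodePosNum (s : SignType) (p : PosNum) :
    rowVal ((encodePosNum p).map fun b => if b then s else 0) = s * (p : ℤ) := by
  induction p with
  | one => simp [encodePosNum, rowVal]
  | bit0 p ih =>
    simp only [encodePosNum, List.map_cons, rowVal, ih, PosNum.cast_bit0]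
    simp
    ring
  | bit1 p ih =>
    simp only [encodePosNum, List.map_cons, rowVal, ih, PosNum.cast_bit1]
    simp
    ring

theorem rowVal_map_encodeNat (s : SignType) (n : ℕ) :
    rowVal ((encodeNat n).map fun b => if b then s else 0) = s * (n : ℤ) := by
  have h : ((n : Num) : ℤ) = (n : ℤ) := by
    rw [← Num.cast_to_nat, Num.to_of_nat]
  rw [← h, encodeNat]
  cases (n : Num) with
  | zero => simp [encodeNum, rowVal]
  | pos p => exact rowVal_map_encodePosNum s p

theorem rowVal_intDigits (z : ℤ) : rowVal (intDigits z) = z := by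
  rw [intDigits, rowVal_map_encodeNat]
  split_ifs with h
  · simp [abs_of_neg h]
  · simp [abs_of_nonneg (not_lt.1 h)]

/-- Process one symbol of the raw input; `carry` holds the sign of the current integer. -/
def normStep : Letter → Prog (Stk k) Letter
  | raw (.bit b) => pop carry fun o => match o with
    | some (dig s) => seq (push carry (dig s)) (push tmp (dig (if b then s else 0)))
    | _ => push carry (dig (if b then -1 else 1))
  | raw .comma => seq (pop carry fun _ => skip) (push tmp comma)
  | raw .ket => push tmp (ket 0)
  | _ => skip

/-- Replace the raw input on `acc` by the marked columns it represents, in reverse on `tmp`. -/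
def normLoop : Prog (Stk k) Letter :=
  loop acc normStep

theorem normLoop_step {S S₁ S' : Stk k → List Letter} {a : Letter} {T : List Letter} {n j : ℕ}
    (hacc : S acc = a :: T) (h : (normStep a).Run (update S acc T) S₁ j) (hj : j ≤ 3)
    (h' : normLoop.Run S₁ S' n) : normLoop.Run S S' (n + 4) :=
  (Run.loop_cons hacc h h').mono (by omega)

theorem run_normLoop_bits (s : SignType) : ∀ (l : List Bool) {S S' : Stk k → List Letter}
    {T : List Letter} {n : ℕ}, S acc = (l.map fun b => raw (.bit b)) ++ T → S carry = [dig s] →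
    normLoop.Run (update (update S acc T) tmp
      ((l.map fun b => dig (if b then s else 0)).reverse ++ S tmp)) S' n →
    normLoop.Run S S' (n + 4 * l.length)
  | [], S, S', T, n, h1, h2, h => by
    refine Run.mono (n := n) ?_ (by simp)
    convert h using 1
    funext z
    simp only [update_apply]
    split_ifs <;> simp_all
  | b :: l, S, S', T, n, h1, h2, h => by
    refine (normLoop_step h1 (j := 3) (S₁ := update (update S acc
      ((l.map fun b => raw (.bit b)) ++ T)) tmp (dig (if b then s else 0) :: S tmp)) ?_ le_rfl
      (run_normLoop_bits s l (T := T) (n := n) ?_ ?_ ?_)).mono ?_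
    · refine (Run.pop (n := 2) ?_).mono (by omega)
      simp only [ne_eq, reduceCtorEq, not_false_eq_true, update_of_ne, h2, List.head?_cons,
        List.tail_cons]
      refine (Run.seq (.push ..) (.push ..)).congr ?_ le_rfl
      funext z
      simp only [update_apply]
      split_ifs <;> simp_all
    · simp
    · simp [h2]
    · convert h using 1
      funext z
      simp only [update_apply]
      split_ifs <;> simp_all
    · simp; omega

/-- An empty `carry` says that the next bit is a sign. The sign is kept there, turned into the digit
value of each following `1`, and discarded at the comma. -/
theorem run_normLoop_int (z : ℤ) {S S' : Stk k → List Letter} {T : List Letter} {n : ℕ}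
    (h1 : S acc = (encodeInt z).map raw ++ raw .comma :: T) (h2 : S carry = [])
    (h : normLoop.Run (update (update S acc T) tmp
      (((intDigits z).map dig ++ [comma]).reverse ++ S tmp)) S' n) :
    normLoop.Run S S' (n + 4 * ((encodeInt z).length + 1)) := by
  simp only [encodeInt, List.map_cons, List.map_map, List.cons_append] at h1
  refine (normLoop_step h1 (j := 2) (S₁ := update (update S acc
      (((encodeNat z.natAbs).map fun b => raw (.bit b)) ++ raw .comma :: T)) carry
      [dig (if z < 0 then -1 else 1)]) ?_ (by omega)
      (run_normLoop_bits (if z < 0 then -1 else 1) (encodeNat z.natAbs) (T := raw .comma :: T)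
        ?_ ?_ (normLoop_step (a := raw .comma) (T := T) (n := n) ?_
          (.seq (.pop (.skip _)) (.push ..)) (by omega) ?_))).mono ?_
  · refine (Run.pop (n := 1) ?_).mono (by omega)
    simp only [ne_eq, reduceCtorEq, not_false_eq_true, update_of_ne, h2, List.head?_nil]
    refine (Run.push ..).congr ?_ le_rfl
    funext z
    simp only [update_apply]
    split_ifs <;> simp_all [comp_def]
  · simp
  · simp
  · simp
  · convert h using 1
    funext z
    simp only [update_apply, intDigits]
    split_ifs <;> simp_all [comp_def]
  · simp [encodeInt]
    omega

theorem run_normLoop_column : ∀ (l : List ℤ) {S S' : Stk k → List Letter} {T : List Letter} {n : ℕ},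
    S acc = (encodeColumn l).map raw ++ T → S carry = [] →
    normLoop.Run (update (update S acc T) tmp
      ((encCol (l.map intDigits)).reverse ++ S tmp)) S' n →
    normLoop.Run S S' (n + 4 * (encodeColumn l).length)
  | [], S, S', T, n, h1, h2, h => by
    refine Run.mono (n := n) ?_ (by simp)
    convert h using 1
    funext z
    simp only [update_apply]
    split_ifs <;> simp_all [encodeColumn]
  | z :: l, S, S', T, n, h1, h2, h => by
    refine (run_normLoop_int z (T := (encodeColumn l).map raw ++ T) (by simp [h1, encodeColumn]) h2
      (run_normLoop_column l (T := T) (n := n) ?_ ?_ ?_)).mono ?_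
    · simp
    · simp [h2]
    · convert h using 1
      funext z
      simp only [update_apply]
      split_ifs <;> simp_all
    · simp [encodeColumn]
      omega

/-- The marked columns of a matrix, given by its columns, with all marks zero. -/
def unmarked (M : List (List ℤ)) : List (Column × SignType) :=
  M.map fun l => (l.map intDigits, 0)

theorem run_normLoop_columns : ∀ (M : List (List ℤ)) {S : Stk k → List Letter},
    S acc = (M.flatMap fun col => encodeColumn col ++ [Γ'.ket]).map raw → S carry = [] →
    normLoop.Run S (update (update S acc []) tmp ((encCols (unmarked M)).reverse ++ S tmp))
      (4 * (M.flatMap fun col => encodeColumn col ++ [Γ'.ket]).length + 1)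
  | [], S, h1, h2 => by
    refine (Run.loop_nil (by simpa using h1)).congr ?_ (by simp)
    funext z
    simp only [update_apply]
    split_ifs <;> simp_all [unmarked]
  | l :: M, S, h1, h2 => by
    refine (run_normLoop_column l
      (T := raw .ket :: (M.flatMap fun col => encodeColumn col ++ [Γ'.ket]).map raw)
      (by simp [h1]) h2 (normLoop_step (a := raw .ket)
        (T := (M.flatMap fun col => encodeColumn col ++ [Γ'.ket]).map raw) ?_ (.push ..) (by omega)
        (run_normLoop_columns M ?_ ?_))).congr ?_ ?_
    · simp
    · simp
    · simp [h2]
    · funext z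
      simp only [update_apply, unmarked]
      split_ifs <;> simp_all
    · simp
      omega

theorem run_normLoop_bras {M : List Letter} {S' : Stk k → List Letter} {n : ℕ} :
    ∀ (m : ℕ) {S : Stk k → List Letter},
    S acc = List.replicate m (raw .bra) ++ M →
    normLoop.Run (update S acc M) S' n → normLoop.Run S S' (n + 4 * m)
  | 0, S, h1, h => by
    simp only [List.replicate_zero, List.nil_append] at h1
    rw [← h1, update_eq_self] at h
    exact h.mono (by omega)
  | m + 1, S, h1, h => by
    refine (normLoop_step (a := raw .bra) (T := List.replicate m (raw .bra) ++ M)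
      (by simpa [List.replicate_succ] using h1) (.skip _) (by omega)
      (run_normLoop_bras (M := M) (n := n) m ?_ ?_)).mono ?_
    · simp
    · simpa using h
    · omega

/-- The columns of the matrix of an instance. -/
def Instance.columns (I : Instance) : List (List ℤ) :=
  List.ofFn fun j => List.ofFn fun i => I.coeff i j

theorem encodeInstance_eq (I : Instance) : encodeInstance I = List.replicate I.m Γ'.bra ++
    I.columns.flatMap fun col => encodeColumn col ++ [Γ'.ket] :=
  rfl

theorem length_encCol_le (l : List ℤ) :
    (encCol (l.map intDigits)).length ≤ (encodeColumn l).length := by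
  induction l with
  | nil => simp
  | cons z l ih =>
    simp [encodeColumn, encodeInt, intDigits] at *
    omega

/-- Each bit of an absolute value becomes one digit and sign bits disappear, so normalisation does
not lengthen the string. -/
theorem length_encCols_unmarked_le (M : List (List ℤ)) : (encCols (unmarked M)).length ≤
    (M.flatMap fun col => encodeColumn col ++ [Γ'.ket]).length := by
  induction M with
  | nil => simp [unmarked]
  | cons l M ih =>
    have := length_encCol_le l
    simp [unmarked] at *
    omega

/-- The decision program. -/
def decider (k : ℕ) : Prog (Stk k) Letter :=
  seq (loop src fun x => push acc (id x)) <| seq normLoop <|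
    seq (loop tmp fun x => push (inp ⟨k, k.lt_succ_self⟩) (id x)) (search k k.lt_succ_self)

open Classical in
theorem run_decider (k : ℕ) (I : Instance) :
    (decider k).Run (update (fun _ => []) src ((encodeInstance I).map raw).reverse)
      (update (fun _ => []) flag (bit (decide (Reachable k (unmarked I.columns)))))
      (searchTime (encodeInstance I).length k + 8 * (encodeInstance I).length + 3) := by
  have hlen := length_encCols_unmarked_le I.columns
  have hI := encodeInstance_eq I
  have hlen' := congrArg List.length hI
  simp only [List.length_append, List.length_replicate] at hlen'
  refine (Run.seq (run_move (by simp) _ _ _ (update_self ..)) <|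
    .seq (run_normLoop_bras
      (M := (I.columns.flatMap fun col => encodeColumn col ++ [Γ'.ket]).map raw) I.m ?_ (run_normLoop_columns I.columns ?_ ?_)) <|
    .seq (run_move (by simp) _ (encCols (unmarked I.columns)).reverse _ ?_)
      (run_search (r := I.m) (N := (encodeInstance I).length) k k.lt_succ_self
        (unmarked I.columns) _ false ?_ ⟨?_, ?_, ?_, ?_, ?_, ?_, ?_⟩ ?_ ?_ ?_)).congr ?_ ?_
  · simp [hI]
  · simp
  · simp
  · simp
  · simp [unmarked, Instance.columns]
  · simp
  · simp
  · simp
  · simp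
  · simp
  · intro i hi
    have : i ≠ ⟨k, k.lt_succ_self⟩ := by
      rintro rfl
      simp at hi
    simp [this]
  · simp
  · simp
  · omega
  · simp [bit]
  · funext z
    simp only [update_apply, Bool.false_or]
    split_ifs <;> simp_all
  · simp only [List.length_reverse, List.length_map]
    omega

end QCommute

/-! ### Reduction from Hamiltonians to sparse kernel vectors. -/

namespace QCommute

open Function

/-! ### Commuting Hamiltonians and solutions of the linear system -/

/-- The eigenvalue of `σᶻ`: `1` on `|0⟩` and `-1` on `|1⟩`. -/
def spin (b : Fin 2) : ℤ :=
  if b = 0 then 1 else -1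

theorem sigmaZ_apply {n : ℕ} (j : Fin n) (x y : Fin n → Fin 2) :
    sigmaZ j x y = if x = y then (spin (x j) : ℂ) else 0 := by
  simp only [sigmaZ, tensorOp, Matrix.of_apply]
  split_ifs with h
  · subst h
    rw [Finset.prod_eq_single j]
    · simp only [if_true, SiteOp.toMatrix]
      generalize x j = b
      fin_cases b <;> simp [spin]
    · intro i _ hi
      simp [hi]
    · simp
  · obtain ⟨i, hi⟩ := Function.ne_iff.1 h
    refine Finset.prod_eq_zero (Finset.mem_univ i) ?_
    split_ifs
    · simp only [SiteOp.toMatrix]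
      generalize x i = a at *
      generalize y i = b at *
      fin_cases a <;> fin_cases b <;> simp at *
    · simp [hi]

theorem constraintOp_eq_diagonal {n : ℕ} (c : Fin n → ℤ) :
    constraintOp c = Matrix.diagonal fun x => ((∑ j, c j * spin (x j) : ℤ) : ℂ) := by
  ext x y
  simp only [constraintOp, Matrix.sum_apply, Matrix.smul_apply, sigmaZ_apply, smul_eq_mul,
    Matrix.diagonal_apply]
  split_ifs with h
  · push_cast
    rfl
  · simp

/-- For diagonal `D`, the commutator has entries `H x y * (D y - D x)`. -/
theorem commute_constraintOp_iff {n : ℕ} (H : QubitOp n) (c : Fin n → ℤ) :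
    H * constraintOp c = constraintOp c * H ↔
      ∀ x y, H x y ≠ 0 → ∑ j, c j * spin (x j) = ∑ j, c j * spin (y j) := by
  rw [constraintOp_eq_diagonal, ← Matrix.ext_iff]
  refine forall₂_congr fun x y => ?_
  rw [Matrix.mul_diagonal, Matrix.diagonal_mul, mul_comm, mul_eq_mul_right_iff, Int.cast_inj]
  tauto

/-- Half the difference of the spins of the row and the column, at the nonzero entries of a
single-qubit operator. -/
def SiteOp.jump : SiteOp → SignType
  | .one => 0
  | .z => 0
  | .plus => 1
  | .minus => -1

theorem SiteOp.spin_sub_spin {s : SiteOp} {a b : Fin 2} (h : s.toMatrix a b ≠ 0) :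
    spin a - spin b = 2 * s.jump := by
  cases s <;> fin_cases a <;> fin_cases b <;> simp [toMatrix, spin, jump] at *

theorem basisTerm_ne_zero_iff {n : ℕ} (s : Fin n → SiteOp) (x y : Fin n → Fin 2) :
    basisTerm s x y ≠ 0 ↔ ∀ i, (s i).toMatrix (x i) (y i) ≠ 0 := by
  simp [basisTerm, tensorOp, Finset.prod_eq_zero_iff]

/-- A nonzero solution with entries in `{-1, 0, 1}`, at most `k` of them nonzero, of the linear
system of an instance. -/
def Instance.IsSol (I : Instance) (k : ℕ) (u : Fin I.n → SignType) : Prop :=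
  u ≠ 0 ∧ (Finset.univ.filter fun j => u j ≠ 0).card ≤ k ∧ ∀ i, ∑ j, (u j : ℤ) * I.coeff i j = 0

/-- The two eigenvalues differ by twice the pairing of `c` with the jump vector. -/
theorem sum_spin_eq_iff {n : ℕ} (c : Fin n → ℤ) {s : Fin n → SiteOp} {x y : Fin n → Fin 2}
    (h : ∀ i, (s i).toMatrix (x i) (y i) ≠ 0) :
    ∑ j, c j * spin (x j) = ∑ j, c j * spin (y j) ↔ ∑ j, ((s j).jump : ℤ) * c j = 0 := by
  have : ∑ j, c j * spin (x j) - ∑ j, c j * spin (y j) = 2 * ∑ j, ((s j).jump : ℤ) * c j := by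
    rw [← Finset.sum_sub_distrib, Finset.mul_sum]
    refine Finset.sum_congr rfl fun j _ => ?_
    rw [← mul_sub, SiteOp.spin_sub_spin (h j)]
    ring
  omega

/-- The solution is the jump vector of a term contributing to an off-diagonal entry. Its support
lies in that of the term, hence the bound `k`. The transposed entry needs a second term, hence the
bound `2`. -/
theorem exists_isSol_of_kLocal {k c d : ℕ} {I : Instance} (h : KLocal k c d I) :
    2 ≤ c * (I.n + 1) ^ d ∧ ∃ u, I.IsSol k u := by
  obtain ⟨H, α, rfl, hcard, hk, hH, hcomm, x, y, hxy, hne⟩ := h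
  set H := ∑ s, α s • basisTerm s with hHdef
  have hterm : ∀ x y, H x y ≠ 0 → ∃ s, α s ≠ 0 ∧ ∀ i, (s i).toMatrix (x i) (y i) ≠ 0 := by
    intro x y h
    rw [hHdef, Matrix.sum_apply] at h
    obtain ⟨s, -, hs⟩ := Finset.exists_ne_zero_of_sum_ne_zero h
    rw [Matrix.smul_apply, smul_eq_mul, mul_ne_zero_iff, basisTerm_ne_zero_iff] at hs
    exact ⟨s, hs⟩
  obtain ⟨s, hs, hsx⟩ := hterm x y hne
  obtain ⟨j, hj⟩ := Function.ne_iff.1 hxy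
  have hne' : H y x ≠ 0 := by
    rw [← hH.apply y x]
    simpa using hne
  obtain ⟨s', hs', hsx'⟩ := hterm y x hne'
  have hsj := SiteOp.spin_sub_spin (hsx j)
  have hsj' := SiteOp.spin_sub_spin (hsx' j)
  have hspin : spin (x j) ≠ spin (y j) := by
    revert hj
    generalize x j = a
    generalize y j = b
    revert a b
    decide
  refine ⟨hcard.trans' ?_, fun i => (s i).jump, fun h0 => ?_, ?_, fun i => ?_⟩
  -- At a site where `x` and `y` differ, the jumps of `s` and `s'` are nonzero and opposite.
  · have hss : s ≠ s' := by
      rintro rfl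
      omega
    rw [← Set.ncard_pair hss]
    exact Set.ncard_le_ncard (by rintro _ (rfl | rfl) <;> assumption) (Set.toFinite _)
  · have := congrFun h0 j
    simp only [Pi.zero_apply] at this
    rw [this] at hsj
    simp at hsj
    omega
  · refine (hk s hs).trans' (Finset.card_le_card fun i => ?_)
    simp only [Finset.mem_filter, Finset.mem_univ, true_and]
    intro h h'
    simp [h', SiteOp.jump] at h
  · rw [← sum_spin_eq_iff _ hsx]
    exact (commute_constraintOp_iff _ _).1 (hcomm i) x y hne

/-- The single-qubit operator changing the spin by a given amount. -/
def siteOfSign : SignType → SiteOp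
  | .zero => .one
  | .pos => .plus
  | .neg => .minus

theorem jump_siteOfSign (s : SignType) : (siteOfSign s).jump = s := by
  cases s <;> rfl

theorem conjTranspose_basisTerm {n : ℕ} (u : Fin n → SignType) :
    (basisTerm fun i => siteOfSign (u i)).conjTranspose = basisTerm fun i => siteOfSign (-u i) := by
  ext x y
  simp only [basisTerm, tensorOp, Matrix.conjTranspose_apply, Matrix.of_apply, star_prod]
  refine Finset.prod_congr rfl fun i _ => ?_
  generalize x i = a
  generalize y i = b
  cases u i <;> fin_cases a <;> fin_cases b <;> simp [siteOfSign, SiteOp.toMatrix]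

theorem kLocal_of_isSol {k c d : ℕ} {I : Instance} (h : 2 ≤ c * (I.n + 1) ^ d)
    {u : Fin I.n → SignType} (hu : I.IsSol k u) : KLocal k c d I := by
  classical
  obtain ⟨h0, hk, hsum⟩ := hu
  obtain ⟨j, hj⟩ := Function.ne_iff.1 h0
  set s : Fin I.n → SiteOp := fun i => siteOfSign (u i) with hs
  set s' : Fin I.n → SiteOp := fun i => siteOfSign (-u i) with hs'
  have hss : s ≠ s' := by
    intro h
    have h1 := congrArg SiteOp.jump (congrFun h j)
    simp only [hs, hs', jump_siteOfSign] at h1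
    revert hj h1
    simp only [Pi.zero_apply]
    cases u j <;> decide
  have hsupp : ∀ t, (if t = s ∨ t = s' then (1 : ℂ) else 0) ≠ 0 ↔ t = s ∨ t = s' := by
    intro t
    split_ifs with ht <;> simp [ht]
  have hH : ∑ t, (if t = s ∨ t = s' then (1 : ℂ) else 0) • basisTerm t =
      basisTerm s + basisTerm s' := by
    rw [← Finset.sum_pair hss]
    simp only [ite_smul, one_smul, zero_smul]
    rw [← Finset.sum_filter]
    refine Finset.sum_congr ?_ fun _ _ => rfl
    ext t
    simp
  have hct : (basisTerm s).conjTranspose = basisTerm s' := conjTranspose_basisTerm u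
  refine ⟨_, fun t => if t = s ∨ t = s' then 1 else 0, rfl, ?_, ?_, ?_, ?_, ?_⟩
  · refine h.trans' ?_
    simp only [hsupp]
    exact (Set.ncard_insert_le s {s'}).trans (by simp)
  · intro t ht
    refine hk.trans' (Finset.card_le_card fun i => ?_)
    simp only [Finset.mem_filter, Finset.mem_univ, true_and]
    rcases (hsupp t).1 ht with rfl | rfl <;> intro h1 h2 <;> simp [hs, hs', h2, siteOfSign] at h1
  · rw [hH, Matrix.IsHermitian, Matrix.conjTranspose_add, ← hct, Matrix.conjTranspose_conjTranspose,
      add_comm]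
  · intro i
    rw [hH, commute_constraintOp_iff]
    intro x y hxy
    rw [Matrix.add_apply] at hxy
    have : basisTerm s x y ≠ 0 ∨ basisTerm s' x y ≠ 0 := by
      by_contra! hcon
      simp [hcon] at hxy
    rcases this with h1 | h1
    · rw [sum_spin_eq_iff _ ((basisTerm_ne_zero_iff _ _ _).1 h1)]
      simpa [hs, jump_siteOfSign] using hsum i
    · rw [sum_spin_eq_iff _ ((basisTerm_ne_zero_iff _ _ _).1 h1)]
      have := hsum i
      simp only [hs', jump_siteOfSign]
      have hneg : ∀ j, ((-u j : SignType) : ℤ) = -(u j : ℤ) := fun j => by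
        cases u j <;> rfl
      simp [hneg, this]
  -- The unique nonzero entry of `σ⁺` is at `(0, 1)` and that of `σ⁻` at `(1, 0)`; outside the
  -- support of `u` both strings are `0`. The adjoint term vanishes there, so nothing cancels.
  · let x : Fin I.n → Fin 2 := fun i => if u i = -1 then 1 else 0
    let y : Fin I.n → Fin 2 := fun i => if u i = 1 then 1 else 0
    have h1 : basisTerm s x y = 1 := by
      simp only [basisTerm, tensorOp, Matrix.of_apply, x, y, hs]
      refine Finset.prod_eq_one fun i _ => ?_
      rcases u i with _ | _ | _
      · rfl
      · simp [siteOfSign, SiteOp.toMatrix]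
      · simp [siteOfSign, SiteOp.toMatrix]
    have h2 : basisTerm s' x y = 0 := by
      simp only [basisTerm, tensorOp, Matrix.of_apply, x, y, hs']
      refine Finset.prod_eq_zero (Finset.mem_univ j) ?_
      simp only [Pi.zero_apply] at hj
      revert hj
      cases u j <;> simp [siteOfSign, SiteOp.toMatrix]
    refine ⟨x, y, fun hxy => ?_, ?_⟩
    · have := congrFun hxy j
      simp only [x, y] at this
      simp only [Pi.zero_apply] at hj
      revert hj this
      cases u j <;> simp
    · rw [hH, Matrix.add_apply, h1, h2]
      simp

/-- For `n ≥ 1` the base is at least `2`, so the size of `n` no longer matters. -/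
theorem two_le_mul_succ_pow_iff {c d n : ℕ} (hn : n ≠ 0) :
    2 ≤ c * (n + 1) ^ d ↔ 2 ≤ c ∨ c = 1 ∧ d ≠ 0 := by
  have hpos : 1 ≤ (n + 1) ^ d := Nat.one_le_pow _ _ (by omega)
  constructor
  · intro h
    by_contra! hcon
    obtain ⟨h1, h2⟩ := hcon
    interval_cases c
    · simp at h
    · simp [h2 rfl] at h
  · rintro (h | ⟨rfl, h⟩)
    · nlinarith
    · have := Nat.le_self_pow h (n + 1)
      omega

/-- A nonzero `u` forces `n ≠ 0`, so the condition on the number of terms becomes independent of the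
instance. -/
theorem kLocal_iff {k c d : ℕ} {I : Instance} :
    KLocal k c d I ↔ (2 ≤ c ∨ c = 1 ∧ d ≠ 0) ∧ ∃ u, I.IsSol k u := by
  have hn : ∀ u, I.IsSol k u → I.n ≠ 0 := by
    rintro u ⟨h0, -⟩ hn
    obtain ⟨j, -⟩ := Function.ne_iff.1 h0
    exact absurd j.2 (by omega)
  constructor
  · intro h
    obtain ⟨h1, u, hu⟩ := exists_isSol_of_kLocal h
    exact ⟨(two_le_mul_succ_pow_iff (hn u hu)).1 h1, u, hu⟩
  · rintro ⟨h1, u, hu⟩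
    exact kLocal_of_isSol ((two_le_mul_succ_pow_iff (hn u hu)).2 h1) hu

end QCommute

/-! ### Correctness of the search, and polynomial running time. -/

namespace QCommute

open Function Prog Stk

/-! ### Correctness of the search -/

theorem reachable_zero_iff {n r : ℕ} (X : Fin n → Column) (hX : ∀ j, (X j).length = r)
    (u : Fin n → SignType) : Reachable 0 (List.ofFn fun j => (X j, u j)) ↔
      ∀ i < r, ∑ j, (u j : ℤ) * colVal (X j) i = 0 := by
  have hr : ∀ c ∈ List.ofFn (fun j => (X j, u j)), c.1.length = r := by
    intro c hc
    obtain ⟨j, rfl⟩ := List.mem_ofFn.1 hc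
    exact hX j
  have hval : ∀ i < r, colVal (total (List.ofFn fun j => (X j, u j)) []) i =
      ∑ j, (u j : ℤ) * colVal (X j) i := by
    intro i hi
    rw [colVal_total i hi _ _ hr, List.map_ofFn, List.sum_ofFn]
    simp [colVal, rowVal]
  rw [Reachable, zeroDigits_encCol]
  have hlen := length_total _ [] hr (Nat.zero_le _)
  constructor
  · intro h i hi
    rw [← hval i hi]
    by_cases hi' : i < (total (List.ofFn fun j => (X j, u j)) []).length
    · exact h i hi'
    · simp [colVal, hi', rowVal]
  · intro h i hi
    rw [hval i (by omega), h i (by omega)]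

theorem reachable_succ_iff {n t : ℕ} (X : Fin n → Column) (u : Fin n → SignType) :
    Reachable (t + 1) (List.ofFn fun j => (X j, u j)) ↔
      ∃ j, ∃ m : SignType, m ≠ 0 ∧ Reachable t (List.ofFn fun i => (X i, update u j m i)) := by
  have key : ∀ (j : Fin n) (m : SignType), (List.ofFn fun i => (X i, update u j m i)) =
      (List.ofFn fun i => (X i, u i)).set j (X j, m) := by
    intro j m
    refine List.ext_getElem (by simp) fun i h1 h2 => ?_
    rw [List.getElem_set]
    split_ifs with h
    · subst h
      simp
    · have : (⟨i, by simpa using h1⟩ : Fin n) ≠ j := fun h' => h (by rw [← h'])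
      simp [this]
  have sign_ne : ∀ m : SignType, m ≠ 0 ↔ m = 1 ∨ m = -1 := by decide
  simp only [key, sign_ne]
  constructor
  · rintro ⟨pre, Y, s, post, h, h'⟩
    have hlen := congrArg List.length h
    simp only [List.length_ofFn, List.length_append, List.length_cons] at hlen
    have hY : Y = X ⟨pre.length, by omega⟩ := by
      have h1 : (List.ofFn fun j => (X j, u j))[pre.length]? = some (Y, s) := by
        rw [h]
        simp
      rw [List.getElem?_eq_getElem (by simp; omega)] at h1
      simp only [List.getElem_ofFn, Option.some.injEq, Prod.mk.injEq] at h1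
      exact h1.1.symm
    subst hY
    refine ⟨⟨pre.length, by omega⟩, ?_⟩
    rw [h]
    rcases h' with h' | h'
    · exact ⟨1, .inl rfl, by simpa using h'⟩
    · exact ⟨-1, .inr rfl, by simpa using h'⟩
  · rintro ⟨j, m, hm, h⟩
    rw [List.set_eq_take_append_cons_drop, if_pos (by simp)] at h
    refine ⟨(List.ofFn fun j => (X j, u j)).take j, X j, u j,
      (List.ofFn fun j => (X j, u j)).drop (j + 1), ?_, hm.imp ?_ ?_⟩
    · conv_lhs => rw [← List.take_append_drop j (List.ofFn fun j => (X j, u j))]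
      rw [List.drop_eq_getElem_cons (by simp)]
      simp
    · rintro rfl
      exact h
    · rintro rfl
      exact h

/-- Each move enlarges the support by at most one site and leaves a nonzero mark, so the final
vector is nonzero if any move was made. -/
theorem exists_sol_of_reachable {n r : ℕ} (X : Fin n → Column) (hX : ∀ j, (X j).length = r)
    (t : ℕ) : ∀ u : Fin n → SignType, Reachable t (List.ofFn fun j => (X j, u j)) →
      ∃ v : Fin n → SignType, (t ≠ 0 ∨ u ≠ 0 → v ≠ 0) ∧
        (Finset.univ.filter fun j => v j ≠ 0).card ≤
          (Finset.univ.filter fun j => u j ≠ 0).card + t ∧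
        ∀ i < r, ∑ j, (v j : ℤ) * colVal (X j) i = 0 := by
  induction t with
  | zero =>
    intro u h
    exact ⟨u, by simp, by simp, (reachable_zero_iff X hX u).1 h⟩
  | succ t ih =>
    intro u h
    obtain ⟨j, m, hm, h⟩ := (reachable_succ_iff X u).1 h
    obtain ⟨v, h1, h2, h3⟩ := ih _ h
    refine ⟨v, fun _ => h1 (.inr fun h0 => hm ?_), ?_, h3⟩
    · simpa using congrFun h0 j
    · have hsub : (Finset.univ.filter fun i => update u j m i ≠ 0) ⊆
          insert j (Finset.univ.filter fun i => u i ≠ 0) := by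
        intro i
        by_cases hij : i = j <;> simp [hij]
      have := (Finset.card_le_card hsub).trans (Finset.card_insert_le _ _)
      omega

/-- Starting from marks that agree with `v` wherever they are nonzero, each move corrects one wrong
mark. -/
theorem reachable_of_sol {n r : ℕ} (X : Fin n → Column) (hX : ∀ j, (X j).length = r)
    {v : Fin n → SignType} (hv : v ≠ 0) (hsum : ∀ i < r, ∑ j, (v j : ℤ) * colVal (X j) i = 0)
    (t : ℕ) : ∀ u : Fin n → SignType, (∀ j, u j = 0 ∨ u j = v j) →
      (Finset.univ.filter fun j => u j ≠ v j).card ≤ t →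
      Reachable t (List.ofFn fun j => (X j, u j)) := by
  induction t with
  | zero =>
    intro u hu hcard
    have : u = v := by
      funext j
      by_contra hj
      have : 0 < (Finset.univ.filter fun j => u j ≠ v j).card :=
        Finset.card_pos.2 ⟨j, by simpa using hj⟩
      omega
    rw [this, reachable_zero_iff X hX]
    exact hsum
  | succ t ih =>
    intro u hu hcard
    rw [reachable_succ_iff]
    -- When no mark is wrong, the surplus move rewrites some nonzero entry of `v` with its own
    -- value; this uses `v ≠ 0`.
    obtain ⟨j, hj, hd⟩ : ∃ j, v j ≠ 0 ∧
        ((Finset.univ.filter fun i => u i ≠ v i).Nonempty → u j ≠ v j) := by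
      by_cases hne : (Finset.univ.filter fun i => u i ≠ v i).Nonempty
      · obtain ⟨j, hj⟩ := hne
        have hj : u j ≠ v j := (Finset.mem_filter.1 hj).2
        refine ⟨j, fun h0 => hj ?_, fun _ => hj⟩
        rcases hu j with h | h
        · rw [h, h0]
        · exact h
      · obtain ⟨j, hj⟩ := Function.ne_iff.1 hv
        exact ⟨j, hj, fun h => absurd h hne⟩
    refine ⟨j, v j, hj, ih _ (fun i => ?_) ?_⟩
    · by_cases hij : i = j
      · subst hij
        simp
      · simpa [hij] using hu i
    · have hsub : (Finset.univ.filter fun i => update u j (v j) i ≠ v i) ⊆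
          (Finset.univ.filter fun i => u i ≠ v i).erase j := by
        intro i
        by_cases hij : i = j
        · subst hij
          simp
        · simp [hij]
      have h1 := Finset.card_le_card hsub
      by_cases hne : (Finset.univ.filter fun i => u i ≠ v i).Nonempty
      · rw [Finset.card_erase_of_mem (by simpa using hd hne)] at h1
        omega
      · rw [Finset.not_nonempty_iff_eq_empty.1 hne, Finset.erase_empty, Finset.card_empty] at h1
        omega

/-- For `k = 0` the search would accept the zero vector, hence the restriction on `k`. -/
theorem reachable_unmarked_iff {k : ℕ} (hk : k ≠ 0) (I : Instance) :
    Reachable k (unmarked I.columns) ↔ ∃ u, I.IsSol k u := by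
  set X : Fin I.n → Column := fun j => List.ofFn fun i => intDigits (I.coeff i j) with hXdef
  have hX : ∀ j, (X j).length = I.m := fun j => by simp [X]
  have hL : unmarked I.columns = List.ofFn fun j => (X j, (0 : Fin I.n → SignType) j) := by
    simp [unmarked, Instance.columns, List.map_ofFn, comp_def, X]
  have hval : ∀ u : Fin I.n → SignType, (∀ i < I.m, ∑ j, (u j : ℤ) * colVal (X j) i = 0) ↔
      ∀ i, ∑ j, (u j : ℤ) * I.coeff i j = 0 := by
    intro u
    have : ∀ (i : ℕ) (hi : i < I.m) j, colVal (X j) i = I.coeff ⟨i, hi⟩ j := by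
      intro i hi j
      simp [colVal, X, hi, rowVal_intDigits]
    constructor
    · intro h i
      simpa [this i.1 i.2] using h i.1 i.2
    · intro h i hi
      simpa [this i hi] using h ⟨i, hi⟩
  rw [hL]
  constructor
  · intro h
    obtain ⟨v, h1, h2, h3⟩ := exists_sol_of_reachable X hX k 0 h
    exact ⟨v, h1 (.inl hk), by simpa using h2, (hval v).1 h3⟩
  · rintro ⟨v, h1, h2, h3⟩
    exact reachable_of_sol X hX h1 ((hval v).2 h3) k 0 (by simp) (by simpa [eq_comm] using h2)

/-! ### Polynomial time -/

/-- The polynomial bounding the running time of `search`. -/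
noncomputable def searchPoly : ℕ → Polynomial ℕ
  | 0 => .X * (16 * .X + 14) + 6 * .X + 6
  | t + 1 => .X * (2 * searchPoly t + 10 * .X + 15) + 2 * .X + 2

theorem eval_searchPoly (N t : ℕ) : (searchPoly t).eval N = searchTime N t := by
  induction t with
  | zero => simp [searchPoly, searchTime]
  | succ t ih => simp [searchPoly, searchTime, ih]

theorem inP_of_forall_not {α A : Type} [Fintype A] (e : Computability.Encoding α A)
    {P : α → Prop} (h : ∀ a, ¬P a) : InP e P := by
  refine inP_of_prog (K := Bool) (G := Unit) e P (loop true fun _ => skip) true false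
    (fun _ => ()) (2 * .X + 1) fun a => ⟨[], by simp, by simp [h], ?_⟩
  refine (run_clear _ _ _ (update_self ..)).congr ?_ (by simp)
  funext x
  cases x <;> simp

end QCommute

theorem mainTheorem7 (k c d : ℕ) :
    QCommute.InP QCommute.instanceEncoding (QCommute.KLocal k c d) := by
  classical
  open QCommute in
  -- Otherwise every instance is a no-instance: fewer than two terms are allowed, or `k = 0` leaves
  -- no room for a nonzero vector.
  by_cases h : (2 ≤ c ∨ c = 1 ∧ d ≠ 0) ∧ k ≠ 0
  · refine inP_of_prog instanceEncoding _ (decider k) .src .flag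
      -- The value at `none` is arbitrary: the machine pushes only symbols that it has read.
      (fun o => o.elim .comma .raw) (searchPoly k + 8 * .X + 3) fun I =>
        ⟨_, ?_, ?_, (run_decider k I).mono ?_⟩
    · simp only [bit]
      split_ifs <;> simp
    · rw [kLocal_iff, reachable_unmarked_iff h.2]
      simp [bit, h.1]
    · simp [eval_searchPoly, instanceEncoding]
  · refine inP_of_forall_not _ fun I hI => h ?_
    obtain ⟨h1, u, hu, hk, -⟩ := kLocal_iff.1 hI
    refine ⟨h1, ?_⟩
    rintro rfl
    obtain ⟨j, hj⟩ := Function.ne_iff.1 hu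
    have : 0 < (Finset.univ.filter fun j => u j ≠ 0).card :=
      Finset.card_pos.2 ⟨j, by simpa using hj⟩
    omega
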